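/- A flat $n$-torus is a quotient $\mathbb{R}^n/\Lambda$ by a lattice $\Lambda$ of rank $n$ with a flat metric $g=c\,(du_1^2+\cdots+du_n^2)$, $c>0$. Let $\lambda_1(g)$ be the smallest positive eigenvalue of its Laplacian $-\Delta_g$ and $V(g)$ its volume. A $\lambda_1$-minimal immersion is an isometric minimal immersion into a unit sphere whose coordinates are eigenfunctions of $-\Delta_g$ for $\lambda_1(g)$ (or zero). $\Lambda^*$ denotes the dual lattice. (1) Every flat 3-torus satisfies $\lambda_1(g)V(g)^{2/3}\le 4\sqrt[3]{2}\,\pi^2$. Equality is attained by the following torus. Let $\eta_1,\eta_2,\eta_3\in\mathbb{R}^3$ have Gram matrix $Q=\begin{pmatrix}1&-\frac12&0\\-\frac12&1&-\frac12\\0&-\frac12&1\end{pmatrix}$ (such vectors exist), let $\Lambda^*=\mathrm{Span}_{\mathbb{Z}}\{\eta_1,\eta_2,\eta_3\}$ and $g=\frac{4\pi^2}{3}(du_1^2+du_2^2+du_3^2)$. With $(\xi_1,\dots,\xi_6)=(\eta_1,\ \eta_2,\ \eta_1+\eta_2,\ \eta_3,\ \eta_2+\eta_3,\ \eta_1+\eta_2+\eta_3)$,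 the map $u\mapsto\frac{1}{\sqrt6}\big(e^{2\pi i\langle\xi_1,u\rangle},\dots,e^{2\pi i\langle\xi_6,u\rangle}\big)$ is a $\lambda_1$-minimal immersion of $(\mathbb{R}^3/\Lambda,g)$ into $\mathbb{S}^{11}$. (2) Every flat 4-torus satisfies $\lambda_1(g)V(g)^{1/2}\le 4\sqrt2\,\pi^2$. Equality is attained by the following $\lambda_1$-minimal tori. Let $\Lambda=\mathrm{Span}_{\mathbb{Z}}\{e_1-e_4,e_2-e_4,e_3-e_4,2e_4\}\subset\mathbb{R}^4$ and $g=\pi^2(du_1^2+\cdots+du_4^2)$. For all $0\le a_1\le a_2\le a_3$ with $a_1^2+a_2^2+a_3^2=\frac14$, the map $$\begin{aligned}u\mapsto\big(&a_1e^{i\pi(u_1+u_2+u_3+u_4)},a_1e^{i\pi(u_1+u_2-u_3-u_4)},a_1e^{i\pi(u_1-u_2+u_3-u_4)},a_1e^{i\pi(-u_1+u_2+u_3-u_4)},\\&a_2e^{i\pi(u_1+u_2+u_3-u_4)},a_2e^{i\pi(u_1+u_2-u_3+u_4)},a_2e^{i\pi(u_1-u_2+u_3+u_4)},a_2e^{i\pi(u_1-u_2-u_3-u_4)},\\&a_3e^{2i\pi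 u_1},a_3e^{2i\pi u_2},a_3e^{2i\pi u_3},a_3e^{2i\pi u_4}\big)\end{aligned}$$ is a $\lambda_1$-minimal immersion of $(\mathbb{R}^4/\Lambda,g)$ into $\mathbb{S}^{23}$ (and $g$ is the induced metric for every choice of $a_1,a_2,a_3$). (3) In lattice terms: the Hermite constants $\gamma_n=\max_{\Lambda}\ \min_{0\ne v\in\Lambda}|v|^2/\mathrm{vol}(\mathbb{R}^n/\Lambda)^{2/n}$, the maximum taken over all lattices $\Lambda\subset\mathbb{R}^n$ of rank $n$, are $\gamma_3=\sqrt[3]{2}$ and $\gamma_4=\sqrt2$. -/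

import Mathlib

open scoped Real ContDiff InnerProductSpace Laplacian

noncomputable section

/-- A flat `n`-torus: the quotient `ℝⁿ / Λ` of Euclidean space by a lattice `Λ` of rank `n`,
carrying the flat Riemannian metric `scale · (du₁² + ⋯ + duₙ²)`. -/
structure FlatTorus (n : ℕ) where
  /-- the lattice `Λ` -/
  lattice : Submodule ℤ (EuclideanSpace ℝ (Fin n))
  discrete : DiscreteTopology lattice
  span_eq_top : Submodule.span ℝ (lattice : Set (EuclideanSpace ℝ (Fin n))) = ⊤
  /-- the constant factor of the metric -/
  scale : ℝ
  scale_pos : 0 < scale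

namespace FlatTorus

variable {n : ℕ}

/-- The points of the torus. -/
abbrev Carrier (T : FlatTorus n) : Type := EuclideanSpace ℝ (Fin n) ⧸ T.lattice

/-- The universal covering `ℝⁿ → ℝⁿ / Λ`. -/
def proj (T : FlatTorus n) : EuclideanSpace ℝ (Fin n) → T.Carrier := T.lattice.mkQ

/-- Smoothness of a map on the torus (the covering is a local diffeomorphism). -/
def IsSmooth (T : FlatTorus n) {F : Type*} [NormedAddCommGroup F] [NormedSpace ℝ F]
    (f : T.Carrier → F) : Prop :=
  ContDiff ℝ ∞ (f ∘ T.proj)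

/-- The Laplace–Beltrami operator of the metric `scale · (du₁² + ⋯ + duₙ²)` applied to a map on
the torus, evaluated at the point below `u ∈ ℝⁿ`; it is `scale⁻¹ · (∂₁² + ⋯ + ∂ₙ²)`. -/
def laplaceBeltrami (T : FlatTorus n) {F : Type*} [NormedAddCommGroup F] [NormedSpace ℝ F]
    (f : T.Carrier → F) (u : EuclideanSpace ℝ (Fin n)) : F :=
  T.scale⁻¹ • (Δ (f ∘ T.proj)) u

/-- `μ` is an eigenvalue of the Laplacian `-Δ` on functions on the torus. -/
def IsEigenvalue (T : FlatTorus n) (μ : ℝ) : Prop :=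
  ∃ f : T.Carrier → ℝ, T.IsSmooth f ∧ f ≠ 0 ∧
    ∀ u, T.laplaceBeltrami f u = -(μ * f (T.proj u))

/-- The set of positive eigenvalues. -/
def positiveSpectrum (T : FlatTorus n) : Set ℝ := {μ | 0 < μ ∧ T.IsEigenvalue μ}

/-- The first eigenvalue `λ₁(g)`: the smallest positive eigenvalue. -/
def lambdaOne (T : FlatTorus n) : ℝ := sInf T.positiveSpectrum

/-- The Riemannian volume `V(g)`: the density of the metric is `scale ^ (n / 2)`, and the Lebesgue
volume of a fundamental domain of the lattice is its covolume. -/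
def volume (T : FlatTorus n) : ℝ := T.scale ^ ((n : ℝ) / 2) * ZLattice.covolume T.lattice

/-- The dilation-invariant functional `λ₁(g) V(g) ^ (2 / n)`. -/
def functional (T : FlatTorus n) : ℝ := T.lambdaOne * T.volume ^ ((2 : ℝ) / n)

/-- `x` is a `λ₁`-minimal immersion of the flat torus into the unit sphere of `ℂᴺ = ℝ²ᴺ`:
a smooth isometric immersion into the sphere that is minimal there and is given by first
eigenfunctions. For an isometric immersion the Laplacian of `x` is the trace of its second
fundamental form in `ℂᴺ`, so `x` is minimal in the sphere exactly if this vector has no component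
tangent to the sphere. -/
structure IsLambdaOneMinimal (T : FlatTorus n) {N : ℕ}
    (x : T.Carrier → EuclideanSpace ℂ (Fin N)) : Prop where
  smooth : T.IsSmooth x
  mem_sphere : ∀ p, ‖x p‖ = 1
  isometric : ∀ u v, ‖fderiv ℝ (x ∘ T.proj) u v‖ ^ 2 = T.scale * ‖v‖ ^ 2
  minimal : ∀ u (w : EuclideanSpace ℂ (Fin N)),
    inner ℝ (x (T.proj u)) w = 0 → inner ℝ (T.laplaceBeltrami x u) w = 0
  first_eigenfunctions : ∀ u, T.laplaceBeltrami x u = -(T.lambdaOne • x (T.proj u))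

end FlatTorus

/-- The lattice dual to `Λ`: all `u` with `⟪u, v⟫ ∈ ℤ` for every `v ∈ Λ`. -/
def dualLattice {n : ℕ} (Λ : Submodule ℤ (EuclideanSpace ℝ (Fin n))) :
    Submodule ℤ (EuclideanSpace ℝ (Fin n)) :=
  LinearMap.BilinForm.dualSubmodule (innerₗ (EuclideanSpace ℝ (Fin n))) Λ

/-! ### The three-dimensional example -/

/-- The Gram matrix `Q` of the dual lattice of the three-dimensional example. -/
def gramThree : Matrix (Fin 3) (Fin 3) ℝ :=
  !![1, -1/2, 0; -1/2, 1, -1/2; 0, -1/2, 1]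

/-- The integer coordinates of the six frequency vectors of the three-dimensional example. -/
def coordsThree : Fin 6 → Fin 3 → ℤ :=
  ![![1, 0, 0], ![0, 1, 0], ![1, 1, 0], ![0, 0, 1], ![0, 1, 1], ![1, 1, 1]]

/-- The map `u ↦ (6^(-1/2) e^{2πi⟨ξ₁,u⟩}, …, 6^(-1/2) e^{2πi⟨ξ₆,u⟩})`, where `ξⱼ` has the integer
coordinates `coordsThree j` with respect to `η`. -/
def immersionThree (η : Fin 3 → EuclideanSpace ℝ (Fin 3)) (u : EuclideanSpace ℝ (Fin 3)) :
    EuclideanSpace ℂ (Fin 6) :=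
  WithLp.toLp 2 fun j =>
    ((√(1 / 6) : ℝ) : ℂ) *
      Complex.exp (2 * π * Complex.I * ((inner ℝ (∑ k, coordsThree j k • η k) u : ℝ) : ℂ))

/-! ### The four-dimensional example -/

/-- The lattice spanned by `e₁ - e₄`, `e₂ - e₄`, `e₃ - e₄`, `2 e₄` in `ℝ⁴`. -/
def latticeFour : Submodule ℤ (EuclideanSpace ℝ (Fin 4)) :=
  Submodule.span ℤ {!₂[1, 0, 0, -1], !₂[0, 1, 0, -1], !₂[0, 0, 1, -1], !₂[0, 0, 0, 2]}

/-- The maps `x` of the four-dimensional example, with parameters `a₁, a₂, a₃`. -/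
def immersionFour (a₁ a₂ a₃ : ℝ) (u : EuclideanSpace ℝ (Fin 4)) : EuclideanSpace ℂ (Fin 12) :=
  let e : ℝ → ℂ := fun t => Complex.exp (π * Complex.I * (t : ℂ))
  !₂[a₁ * e (u 0 + u 1 + u 2 + u 3), a₁ * e (u 0 + u 1 - u 2 - u 3),
    a₁ * e (u 0 - u 1 + u 2 - u 3), a₁ * e (-u 0 + u 1 + u 2 - u 3),
    a₂ * e (u 0 + u 1 + u 2 - u 3), a₂ * e (u 0 + u 1 - u 2 + u 3),
    a₂ * e (u 0 - u 1 + u 2 + u 3), a₂ * e (u 0 - u 1 - u 2 - u 3),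
    a₃ * e (2 * u 0), a₃ * e (2 * u 1), a₃ * e (2 * u 2), a₃ * e (2 * u 3)]

/-! ### Hermite invariants -/

/-- The Hermite invariants `min_{0 ≠ v ∈ Λ} ‖v‖² / vol(ℝⁿ/Λ)^(2/n)` of all lattices `Λ` of rank `n`
in `ℝⁿ`. The Hermite constant `γₙ` is the greatest element of this set. -/
def hermiteInvariants (n : ℕ) : Set ℝ :=
  {γ | ∃ Λ : Submodule ℤ (EuclideanSpace ℝ (Fin n)), DiscreteTopology Λ ∧
    Submodule.span ℝ (Λ : Set (EuclideanSpace ℝ (Fin n))) = ⊤ ∧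
    ∃ m : ℝ, IsLeast {r | ∃ v ∈ Λ, v ≠ 0 ∧ r = ‖v‖ ^ 2} m ∧
      γ = m / ZLattice.covolume Λ ^ ((2 : ℝ) / n)}

end

/-! The eigenfunctions on a flat torus are governed by the characters `u ↦ e^{2πi⟨ξ,u⟩}` with ξ in
the dual lattice, so the positive eigenvalues are 4π²‖ξ‖²/c with ξ ≠ 0, where c is the scale. That
nothing else occurs is seen on Fourier coefficients (`exists_dual_of_laplacian_eq`). Since the
covolumes of Λ and Λ* are inverse to each other and c cancels, λ₁V^{2/n} is 4π² times the Hermite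
invariant of Λ* (`functional_eq`, `functional_le`). The spectral bounds are therefore the values of
γ₃ and γ₄.

The upper bounds on γ₃ and γ₄ come from Korkine–Zolotareff reduction: each basis vector is chosen to
minimise the distance to the span of its predecessors. Let A₁, …, Aₙ be the squared diagonal entries
of the basis in Gram–Schmidt coordinates, so that their product is the squared covolume and A₁ is at
least the squared minimum m. Then A₂ ≥ 3/4 A₁ and A₄ ≥ 3/4 A₃ by rounding one coordinate, and A₃ ≥
2/3 A₁ by the finer `two_thirds_le_of_reduced`. Multiplying gives m³ ≤ 2 covol² and m⁴ ≤ 4 covol².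

Equality holds for the root lattices A₃ = D₃ and D₄, whose minima and Gram determinants are
explicit. A family of characters whose frequencies are shortest dual vectors and whose weighted
frequencies form a tight frame is an isometric immersion by first eigenfunctions
(`isLambdaOneMinimal_of_frame`). The two examples reduce to such frame identities. -/

/-! ### Inequalities between the diagonal entries of a reduced basis -/

/-- The distances to the integers of `a`, `c` and `c - a` sum to at most one. -/
theorem abs_sub_round_add_le_one (a c : ℝ) :
    |a - round a| + |c - round c| + |(c - a) - round (c - a)| ≤ 1 := by
  have h1 := abs_sub_round a
  have h2 := abs_sub_round c
  have h3 (z : ℤ) := round_le (c - a) z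
  -- Let x, y be the residues of a and c, both in [-1/2, 1/2]. If they have the same sign, the sum
  -- is at most |x| + |y| + |y - x| = 2 max(|x|, |y|). If the signs differ, shifting by ±1 bounds
  -- the third distance by 1 - |x| - |y|.
  have e0 := h3 (round c - round a)
  have e1 := h3 (round c - round a + 1)
  have e2 := h3 (round c - round a - 1)
  push_cast at e0 e1 e2
  generalize |c - a - (round (c - a) : ℝ)| = r at *
  set x := a - round a
  set y := c - round c
  have f0 : c - a - ((round c : ℝ) - round a) = y - x := by simp only [x, y]; ring
  have f1 : c - a - ((round c : ℝ) - round a + 1) = y - x - 1 := by simp only [x, y]; ring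
  have f2 : c - a - ((round c : ℝ) - round a - 1) = y - x + 1 := by simp only [x, y]; ring
  rw [f0] at e0
  rw [f1] at e1
  rw [f2] at e2
  clear_value x y
  clear h3 f0 f1 f2
  grind

/-- This is the Korkine–Zolotareff inequality for three vectors, with the first squared diagonal
entry scaled to 1: q and r are the other two, t is the second coordinate of the third vector
relative to the second diagonal entry, and A, C, D are distances of first coordinates to the
integers. With x = min(A, C), the minimality conditions give r ≥ (1 - x²)(1 - t²) and r ≥ 2x(1 -
x)(1 + t). The first decreases and the second increases in t, so only their crossing point matters
when x > 1/3. -/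
theorem two_thirds_le_of_reduced {A C D q t r : ℝ} (hA : 0 ≤ A) (hC : 0 ≤ C) (hD : 0 ≤ D)
    (hA' : A ≤ 1 / 2) (hC' : C ≤ 1 / 2) (hsum : A + C + D ≤ 1)
    (ht : 0 ≤ t) (ht' : t ≤ 1 / 2)
    (h1 : 1 ≤ A ^ 2 + q) (h2 : 1 ≤ C ^ 2 + t ^ 2 * q + r)
    (h3 : 1 ≤ D ^ 2 + (1 - t) ^ 2 * q + r) (h4 : q ≤ t ^ 2 * q + r) : 2 / 3 ≤ r := by
  have ht2 : 0 ≤ 1 - t ^ 2 := by nlinarith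
  obtain ⟨x, hx0, hx1, hx2, hx3⟩ : ∃ x, 0 ≤ x ∧ x ≤ 1 / 2 ∧ (1 - x ^ 2) * (1 - t ^ 2) ≤ r ∧
      D ≤ 1 - 2 * x := by
    rcases le_total A C with h | h
    · refine ⟨A, hA, hA', ?_, by linarith⟩
      have := mul_le_mul_of_nonneg_right (by linarith : 1 - A ^ 2 ≤ q) ht2
      linarith
    · refine ⟨C, hC, hC', ?_, by linarith⟩
      have h5 := mul_le_mul_of_nonneg_right (by linarith : 1 - C ^ 2 ≤ t ^ 2 * q + r) ht2
      have h6 := mul_le_mul_of_nonneg_left h4 (sq_nonneg t)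
      linarith
  have h5 : 2 * x * (1 - x) * (1 + t) ≤ r := by
    have : D ^ 2 ≤ (1 - 2 * x) ^ 2 := by gcongr
    have h6 : (1 - t) ^ 2 * ((1 + t) * q) ≤ (1 - t) * r := by
      linarith [mul_le_mul_of_nonneg_left h4 (by linarith : 0 ≤ 1 - t)]
    have h7 := mul_le_mul_of_nonneg_left
      (by linarith : 4 * x * (1 - x) ≤ (1 - t) ^ 2 * q + r) (by linarith : 0 ≤ 1 + t)
    linarith
  rcases le_or_gt x (1 / 3) with h | h
  -- Here the first bound suffices: 8/9 · 3/4 = 2/3.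
  · have : (8 / 9 : ℝ) ≤ 1 - x ^ 2 := by nlinarith
    have : (3 / 4 : ℝ) ≤ 1 - t ^ 2 := by nlinarith
    nlinarith
  -- The two bounds cross at t = (1 - x)/(1 + x), with common value 4x(1 - x)/(1 + x). That this is
  -- at least 2/3 amounts to (3x - 1)(2x - 1) ≤ 0.
  · have key : 2 / 3 * (1 + x) ≤ 4 * x * (1 - x) := by nlinarith
    refine le_of_mul_le_mul_left ?_ (by linarith : 0 < 1 + x)
    rcases le_total (t * (1 + x)) (1 - x) with h' | h'
    · have h6 : (t * (1 + x)) ^ 2 ≤ (1 - x) ^ 2 := by gcongr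
      have h7 := mul_le_mul_of_nonneg_left
        (by linarith : 4 * x ≤ (1 + x) ^ 2 * (1 - t ^ 2)) (by linarith : 0 ≤ 1 - x)
      have h8 := mul_le_mul_of_nonneg_left hx2 (by linarith : 0 ≤ 1 + x)
      linarith
    · have h7 := mul_le_mul_of_nonneg_left
        (by linarith : 2 ≤ (1 + t) * (1 + x)) (by nlinarith : 0 ≤ 2 * x * (1 - x))
      have h8 := mul_le_mul_of_nonneg_left h5 (by linarith : 0 ≤ 1 + x)
      linarith

/-- Rounding a/p brings the first coordinate into [-|p|/2, |p|/2], which leaves at least p² - p²/4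
for r². -/
theorem three_quarters_le_of_reduced {p a r : ℝ} (hp : p ≠ 0)
    (h : ∀ x : ℤ, p ^ 2 ≤ (x * p + a) ^ 2 + r ^ 2) : 3 / 4 * p ^ 2 ≤ r ^ 2 := by
  have h1 := h (-round (a / p))
  have h2 := abs_sub_round (a / p)
  push_cast at h1
  have h3 : (-(round (a / p) : ℝ) * p + a) ^ 2 = |a / p - round (a / p)| ^ 2 * p ^ 2 := by
    rw [sq_abs, ← mul_pow]
    congr 1
    field_simp
    ring
  rw [h3] at h1
  have h4 : |a / p - round (a / p)| ^ 2 ≤ (1 / 2) ^ 2 := by gcongr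
  nlinarith [sq_nonneg p]

/-- In a Korkine–Zolotareff reduced triple the third squared diagonal entry is at least two thirds
of the first one. -/
theorem two_thirds_le_of_korkineZolotareff {p q r a c d : ℝ} (hp : p ≠ 0) (hq : q ≠ 0)
    (h1 : ∀ x : ℤ, p ^ 2 ≤ (x * p + a) ^ 2 + q ^ 2)
    (h2 : ∀ x y : ℤ, p ^ 2 ≤ (x * p + y * a + c) ^ 2 + (y * q + d) ^ 2 + r ^ 2)
    (h3 : ∀ y : ℤ, q ^ 2 ≤ (y * q + d) ^ 2 + r ^ 2) : 2 / 3 * p ^ 2 ≤ r ^ 2 := by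
  have red (u : ℝ) : (-(round (u / p) : ℝ) * p + u) ^ 2 = |u / p - round (u / p)| ^ 2 * p ^ 2 := by
    rw [sq_abs, ← mul_pow]
    congr 1
    field_simp
    ring
  have main : ∀ c d : ℝ, 0 ≤ d / q → d / q ≤ 1 / 2 →
      (∀ x y : ℤ, p ^ 2 ≤ (x * p + y * a + c) ^ 2 + (y * q + d) ^ 2 + r ^ 2) →
      (∀ y : ℤ, q ^ 2 ≤ (y * q + d) ^ 2 + r ^ 2) → 2 / 3 * p ^ 2 ≤ r ^ 2 := by
    intro c d hd hd' h2 h3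
    have key := two_thirds_le_of_reduced (A := |a / p - round (a / p)|)
      (C := |c / p - round (c / p)|) (D := |(c / p - a / p) - round (c / p - a / p)|)
      (q := q ^ 2 / p ^ 2) (t := d / q) (r := r ^ 2 / p ^ 2) (abs_nonneg _) (abs_nonneg _)
      (abs_nonneg _) (abs_sub_round _) (abs_sub_round _) (abs_sub_round_add_le_one _ _) hd hd'
    have hp2 : 0 < p ^ 2 := by positivity
    rw [le_div_iff₀ hp2] at key
    apply key
    · have := h1 (-round (a / p))
      push_cast at this
      rw [red] at this
      field_simp at this ⊢
      rw [one_le_div₀ hp2]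
      linarith
    · have := h2 (-round (c / p)) 0
      push_cast at this
      rw [zero_mul, add_zero, red] at this
      field_simp at this ⊢
      rw [one_le_div₀ hp2]
      linarith
    -- The choice y = -1 tests the difference of the third and second vectors: this is where D and
    -- (1 - t)² come from.
    · have := h2 (-round (c / p - a / p)) (-1)
      push_cast at this
      have e' : c / p - a / p = (c - a) / p := (sub_div _ _ _).symm
      rw [e', add_assoc (_ * p), neg_one_mul, neg_add_eq_sub, red] at this
      have e : (1 - d / q) ^ 2 * (q ^ 2 / p ^ 2) = (-1 * q + d) ^ 2 / p ^ 2 := by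
        field_simp
        ring
      rw [e, e']
      field_simp at this ⊢
      rw [one_le_div₀ hp2]
      linarith
    · have := h3 0
      push_cast at this
      field_simp
      gcongr
      linarith
  -- Subtracting z times the second vector from the third brings d/q into [-1/2, 1/2], and a change
  -- of sign makes it nonnegative. The hypotheses range over all integers and survive both changes.
  set z := round (d / q) with hz
  have hd : d / q = (-z * q + d) / q + z := by field_simp; ring
  have hdz : |(-z * q + d) / q| ≤ 1 / 2 := by
    have := abs_sub_round (d / q)
    rwa [← hz, hd, add_sub_cancel_right] at this
  rw [abs_le] at hdz
  rcases le_total 0 ((-z * q + d) / q) with h | h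
  · refine main (-z * a + c) (-z * q + d) h hdz.2 (fun x y => ?_) fun y => ?_
    · convert h2 x (y - z) using 3 <;> push_cast <;> ring
    · convert h3 (y - z) using 3; push_cast; ring
  · refine main (-(-z * a + c)) (-(-z * q + d)) (by rw [neg_div]; linarith)
      (by rw [neg_div]; linarith) (fun x y => ?_) fun y => ?_
    · convert h2 (-x) (-y - z) using 2
      rw [← neg_sq, ← neg_sq (y * q + _)]
      push_cast; ring
    · convert h3 (-y - z) using 2
      rw [← neg_sq]
      push_cast; ring

/-! ### Korkine–Zolotareff reduction of lattices -/

section Reduction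

variable {E : Type*} [NormedAddCommGroup E] [InnerProductSpace ℝ E]

open Submodule Module

/-- Points of a subspace spanned by finitely many lattice vectors are at bounded distance from
lattice vectors in that subspace. -/
theorem exists_lattice_near {ι : Type*} [Fintype ι] (L : Submodule ℤ E) (b : ι → E)
    (hb : ∀ i, b i ∈ L) :
    ∃ R : ℝ, ∀ w ∈ span ℝ (Set.range b), ∃ y ∈ L, y ∈ span ℝ (Set.range b) ∧ ‖w - y‖ ≤ R := by
  refine ⟨∑ i, ‖b i‖, fun w hw => ?_⟩
  obtain ⟨c, rfl⟩ := (mem_span_range_iff_exists_fun ℝ).1 hw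
  refine ⟨∑ i, ⌊c i⌋ • b i, sum_mem fun i _ => L.smul_mem _ (hb i), sum_mem fun i _ => ?_, ?_⟩
  · rw [← Int.cast_smul_eq_zsmul ℝ]
    exact smul_mem _ _ (subset_span ⟨i, rfl⟩)
  · rw [← Finset.sum_sub_distrib]
    refine (norm_sum_le _ _).trans (Finset.sum_le_sum fun i _ => ?_)
    rw [← Int.cast_smul_eq_zsmul ℝ, ← sub_smul, norm_smul]
    refine mul_le_of_le_one_left (norm_nonneg _) ?_
    rw [Real.norm_eq_abs, Int.self_sub_floor, Int.abs_fract]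
    exact (Int.fract_lt_one _).le

theorem linearIndependent_of_notMem_span_Iio {n : ℕ} (b : Fin n → E)
    (hb : ∀ i, b i ∉ span ℝ (b '' Set.Iio i)) : LinearIndependent ℝ b := by
  rw [Fintype.linearIndependent_iff]
  intro g hg
  by_contra! hne
  obtain ⟨i, hi, hmax⟩ := Finset.exists_max_image (Finset.univ.filter fun i => g i ≠ 0) id
    (by obtain ⟨i, hi⟩ := hne; exact ⟨i, by simpa using hi⟩)
  simp only [Finset.mem_filter, Finset.mem_univ, true_and, id] at hi hmax
  apply hb i
  have h1 : g i • b i = -∑ j ∈ Finset.univ.erase i, g j • b j := by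
    rw [eq_neg_iff_add_eq_zero, Finset.add_sum_erase _ (fun j => g j • b j) (Finset.mem_univ i),
      hg]
  have h2 : g i • b i ∈ span ℝ (b '' Set.Iio i) := by
    rw [h1]
    refine neg_mem (sum_mem fun j hj => ?_)
    by_cases hj0 : g j = 0
    · simp [hj0]
    · exact smul_mem _ _ (subset_span ⟨j, lt_of_le_of_ne (hmax j hj0) (Finset.ne_of_mem_erase hj),
        rfl⟩)
  exact (smul_mem_iff _ hi).1 h2

variable [FiniteDimensional ℝ E]

theorem finite_lattice_inter_closedBall (L : Submodule ℤ E) [DiscreteTopology L] (R : ℝ) :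
    {x | x ∈ L ∧ ‖x‖ ≤ R}.Finite := by
  have : DiscreteTopology L.toAddSubgroup := (inferInstance : DiscreteTopology L)
  have h : (Metric.closedBall 0 R ∩ (L : Set E)).Finite := by
    change (Metric.closedBall 0 R ∩ (L.toAddSubgroup : Set E)).Finite
    exact Metric.finite_isBounded_inter_isClosed
      DiscreteTopology.isDiscrete Metric.isBounded_closedBall inferInstance
  refine h.subset fun x hx => ⟨by simpa using hx.2, hx.1⟩

/-- Among the lattice vectors outside a subspace spanned by lattice vectors there is one that is
closest to the subspace. -/
theorem exists_min_starProjection {ι : Type*} [Fintype ι] (L : Submodule ℤ E) [DiscreteTopology L]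
    (b : ι → E) (hb : ∀ i, b i ∈ L) (h : ∃ x ∈ L, x ∉ span ℝ (Set.range b)) :
    ∃ x ∈ L, x ∉ span ℝ (Set.range b) ∧ ∀ y ∈ L, y ∉ span ℝ (Set.range b) →
      ‖(span ℝ (Set.range b))ᗮ.starProjection x‖ ≤ ‖(span ℝ (Set.range b))ᗮ.starProjection y‖ := by
  obtain ⟨R, hR⟩ := exists_lattice_near L b hb
  set W := span ℝ (Set.range b) with hW
  -- Subtracting a lattice vector near the component of x in W keeps the orthogonal projection and
  -- bounds the norm. Minimisation thus takes place among finitely many lattice vectors.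
  have red : ∀ x ∈ L, x ∉ W → ∃ y ∈ L, y ∉ W ∧ Wᗮ.starProjection y = Wᗮ.starProjection x ∧
      ‖y‖ ≤ ‖Wᗮ.starProjection x‖ + R := by
    intro x hx hxW
    obtain ⟨y, hyL, hyW, hy⟩ := hR (W.starProjection x) (W.starProjection_apply_mem x)
    refine ⟨x - y, L.sub_mem hx hyL, fun h => hxW ?_, ?_, ?_⟩
    · simpa using W.add_mem h hyW
    · rw [map_sub, starProjection_orthogonal_apply_eq_zero hyW, sub_zero]
    · have : x - y = Wᗮ.starProjection x + (W.starProjection x - y) := by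
        conv_lhs => rw [← W.starProjection_add_starProjection_orthogonal x]
        abel
      rw [this]
      exact (norm_add_le _ _).trans (by gcongr)
  obtain ⟨x₀, hx₀, hx₀W⟩ := h
  set S := {x | (x ∈ L ∧ ‖x‖ ≤ ‖Wᗮ.starProjection x₀‖ + R) ∧ x ∉ W}
  have hS : S.Finite := (finite_lattice_inter_closedBall L _).subset fun x hx => hx.1
  obtain ⟨y₀, hy₀, hy₀W, -, hy₀'⟩ := red x₀ hx₀ hx₀W
  obtain ⟨x, hx, hmin⟩ := Set.exists_min_image S (fun x => ‖Wᗮ.starProjection x‖) hS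
    ⟨y₀, ⟨hy₀, hy₀'⟩, hy₀W⟩
  refine ⟨x, hx.1.1, hx.2, fun y hy hyW => ?_⟩
  obtain ⟨z, hz, hzW, hzy, hzn⟩ := red y hy hyW
  rcases le_total ‖Wᗮ.starProjection y‖ ‖Wᗮ.starProjection x₀‖ with h | h
  · rw [← hzy]
    exact hmin z ⟨⟨hz, hzn.trans (by gcongr)⟩, hzW⟩
  · obtain ⟨w, hw, hwW, hwx, hwn⟩ := red x₀ hx₀ hx₀W
    refine le_trans ?_ h
    rw [← hwx]
    exact hmin w ⟨⟨hw, hwn⟩, hwW⟩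

/-- With the empty family the subspace is zero, and distance to it is the norm. -/
theorem exists_shortest_vector (L : Submodule ℤ E) [DiscreteTopology L] (h : ∃ x ∈ L, x ≠ 0) :
    ∃ m, IsLeast {r | ∃ v ∈ L, v ≠ 0 ∧ r = ‖v‖ ^ 2} m := by
  obtain ⟨x, hx, hx0, hmin⟩ := exists_min_starProjection L (Empty.elim : Empty → E)
    (fun i => i.elim) (by simpa only [Set.range_eq_empty, span_empty, mem_bot] using h)
  simp only [Set.range_eq_empty, span_empty, bot_orthogonal_eq_top, mem_bot] at hx0 hmin
  refine ⟨‖x‖ ^ 2, ⟨x, hx, hx0, rfl⟩, ?_⟩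
  rintro _ ⟨v, hv, hv0, rfl⟩
  have := hmin v hv hv0
  simp only [starProjection_top, ContinuousLinearMap.id_apply] at this
  gcongr

/-- A Korkine–Zolotareff reduced sequence of lattice vectors. -/
theorem exists_reduced_sequence (L : Submodule ℤ E) [DiscreteTopology L]
    (hL : span ℝ (L : Set E) = ⊤) (k : ℕ) (hk : k ≤ finrank ℝ E) :
    ∃ b : Fin k → E, ∀ i, b i ∈ L ∧ b i ∉ span ℝ (b '' Set.Iio i) ∧
      ∀ x ∈ L, x ∉ span ℝ (b '' Set.Iio i) →
        ‖(span ℝ (b '' Set.Iio i))ᗮ.starProjection (b i)‖ ≤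
          ‖(span ℝ (b '' Set.Iio i))ᗮ.starProjection x‖ := by
  induction k with
  | zero => exact ⟨Fin.elim0, fun i => i.elim0⟩
  | succ k ih =>
    obtain ⟨b, hb⟩ := ih (by omega)
    have hne : ∃ x ∈ L, x ∉ span ℝ (Set.range b) := by
      by_contra! hcon
      have h1 : span ℝ (Set.range b) = ⊤ := top_le_iff.1 (hL ▸ span_le.2 hcon)
      have h2 := finrank_range_le_card (R := ℝ) b
      rw [Set.finrank, h1, finrank_top, Fintype.card_fin] at h2
      omega
    obtain ⟨x, hx, hxW, hmin⟩ := exists_min_starProjection L b (fun i => (hb i).1) hne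
    -- Appending a vector leaves the spans of earlier initial segments unchanged, so the earlier
    -- minimality conditions persist.
    have e1 (i : Fin k) : (Fin.snoc b x : Fin (k + 1) → E) '' Set.Iio i.castSucc =
        b '' Set.Iio i := by
      ext y
      simp only [Set.mem_image, Set.mem_Iio]
      constructor
      · rintro ⟨j, hj, rfl⟩
        refine ⟨j.castLT (by have := Fin.lt_def.1 hj; simp at this; omega), hj, ?_⟩
        rw [← Fin.snoc_castSucc (α := fun _ => E) x b, Fin.castSucc_castLT]
      · rintro ⟨j, hj, rfl⟩
        exact ⟨j.castSucc, Fin.castSucc_lt_castSucc_iff.2 hj, Fin.snoc_castSucc _ _ _⟩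
    have e2 : (Fin.snoc b x : Fin (k + 1) → E) '' Set.Iio (Fin.last k) = Set.range b := by
      ext y
      simp only [Set.mem_image, Set.mem_Iio, Set.mem_range]
      constructor
      · rintro ⟨j, hj, rfl⟩
        refine ⟨j.castLT hj, ?_⟩
        rw [← Fin.snoc_castSucc (α := fun _ => E) x b, Fin.castSucc_castLT]
      · rintro ⟨j, rfl⟩
        exact ⟨j.castSucc, Fin.castSucc_lt_last j, Fin.snoc_castSucc _ _ _⟩
    refine ⟨Fin.snoc b x, fun i => ?_⟩
    induction i using Fin.lastCases with
    | last =>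
      rw [e2, Fin.snoc_last]
      exact ⟨hx, hxW, hmin⟩
    | cast i =>
      rw [e1, Fin.snoc_castSucc]
      exact hb i

/-- A Korkine–Zolotareff reduced sequence spans the lattice. -/
theorem span_eq_of_reduced {n : ℕ} (L : Submodule ℤ E) (b : Fin n → E)
    (hspan : span ℝ (Set.range b) = ⊤) (hb : ∀ i, b i ∈ L ∧ b i ∉ span ℝ (b '' Set.Iio i) ∧
      ∀ x ∈ L, x ∉ span ℝ (b '' Set.Iio i) →
        ‖(span ℝ (b '' Set.Iio i))ᗮ.starProjection (b i)‖ ≤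
          ‖(span ℝ (b '' Set.Iio i))ᗮ.starProjection x‖) :
    span ℤ (Set.range b) = L := by
  refine le_antisymm (span_le.2 (by rintro _ ⟨i, rfl⟩; exact (hb i).1)) fun x hx => ?_
  obtain ⟨c, rfl⟩ := (mem_span_range_iff_exists_fun ℝ).1 (hspan ▸ mem_top : x ∈ _)
  set s : Fin n → ℝ := fun i => c i - round (c i) with hs
  have hr : ∑ i, round (c i) • b i ∈ span ℤ (Set.range b) :=
    sum_mem fun i _ => smul_mem _ _ (subset_span ⟨i, rfl⟩)
  have hrL : ∑ i, round (c i) • b i ∈ L := sum_mem fun i _ => L.smul_mem _ (hb i).1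
  have hy : ∑ i, s i • b i = ∑ i, c i • b i - ∑ i, round (c i) • b i := by
    rw [← Finset.sum_sub_distrib]
    refine Finset.sum_congr rfl fun i _ => ?_
    rw [hs, sub_smul, Int.cast_smul_eq_zsmul]
  have hyL : ∑ i, s i • b i ∈ L := hy ▸ L.sub_mem hx hrL
  suffices h0 : ∀ i, s i = 0 by
    simp only [h0, zero_smul, Finset.sum_const_zero] at hy
    rwa [← sub_eq_zero.1 hy.symm] at hr
  by_contra! hne
  -- At the last index i with s i ≠ 0, the remainder projects to s i times the projection of b i. As
  -- |s i| ≤ 1/2, it would be closer to W than b i, against minimality.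
  obtain ⟨i, hi, hmax⟩ := Finset.exists_max_image (Finset.univ.filter fun i => s i ≠ 0) id
    (by obtain ⟨i, hi⟩ := hne; exact ⟨i, by simpa using hi⟩)
  simp only [Finset.mem_filter, Finset.mem_univ, true_and, id] at hi hmax
  obtain ⟨-, hbi, hmin⟩ := hb i
  set W := span ℝ (b '' Set.Iio i)
  have hw : ∑ j ∈ Finset.univ.erase i, s j • b j ∈ W := by
    refine sum_mem fun j hj => ?_
    by_cases hj0 : s j = 0
    · simp [hj0]
    · exact smul_mem _ _ (subset_span ⟨j, lt_of_le_of_ne (hmax j hj0) (Finset.ne_of_mem_erase hj),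
        rfl⟩)
  have hsum := Finset.add_sum_erase Finset.univ (fun j => s j • b j) (Finset.mem_univ i)
  have h1 := hmin _ hyL (fun h => hbi ((smul_mem_iff W hi).1 (by
    rw [← hsum] at h
    exact (W.add_mem_iff_left hw).1 h)))
  rw [← hsum, map_add, starProjection_orthogonal_apply_eq_zero hw, add_zero, map_smul,
    norm_smul] at h1
  have h2 : 0 < ‖Wᗮ.starProjection (b i)‖ := by
    rw [norm_pos_iff]
    intro h0
    rw [starProjection_orthogonal_val, sub_eq_zero] at h0
    exact hbi (h0 ▸ W.starProjection_apply_mem _)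
  have h3 : ‖s i‖ ≤ 1 / 2 := abs_sub_round (c i)
  nlinarith

end Reduction

/-! ### Covolumes, dual bases and triangular coordinates -/

section Covolume

open Submodule Module

variable {n : ℕ}

local notation "𝔼" => EuclideanSpace ℝ (Fin n)

theorem covolume_span_eq_abs_det (b : Basis (Fin n) ℝ 𝔼) (e : OrthonormalBasis (Fin n) ℝ 𝔼) :
    ZLattice.covolume (span ℤ (Set.range b)) = |e.toBasis.det b| := by
  have h := ZLattice.covolume_eq_det_mul_measureReal (span ℤ (Set.range b))
    MeasureTheory.volume (b.restrictScalars ℤ) e.toBasis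
  rw [h, MeasureTheory.measureReal_congr (ZSpan.fundamentalDomain_ae_parallelepiped _ _),
    MeasureTheory.Measure.real]
  rw [OrthonormalBasis.coe_toBasis, e.volume_parallelepiped, ENNReal.toReal_one, mul_one]
  congr 2
  ext i : 1
  simp

theorem dualLattice_span_eq (b : Basis (Fin n) ℝ 𝔼) :
    ∃ b' : Basis (Fin n) ℝ 𝔼, (∀ i j, inner ℝ (b' i) (b j) = if i = j then (1 : ℝ) else 0) ∧
      dualLattice (span ℤ (Set.range b)) = span ℤ (Set.range b') ∧
      dualLattice (span ℤ (Set.range b')) = span ℤ (Set.range b) := by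
  have hB : (innerₗ 𝔼 : LinearMap.BilinForm ℝ 𝔼).Nondegenerate := by
    constructor
    · intro x hx
      simpa using hx x
    · intro x hx
      simpa using hx x
  have hs : LinearMap.BilinForm.IsSymm (innerₗ 𝔼) := ⟨fun x y => by simp [real_inner_comm]⟩
  have h1 := LinearMap.BilinForm.dualSubmodule_span_of_basis (R := ℤ) (innerₗ 𝔼) hB b
  refine ⟨LinearMap.BilinForm.dualBasis (innerₗ 𝔼) hB b, fun i j => ?_, h1, ?_⟩
  · have := LinearMap.BilinForm.apply_dualBasis_left hB b i j
    rw [innerₗ_apply_apply] at this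
    rw [this]
    simp only [eq_comm]
  · rw [← h1]
    exact LinearMap.BilinForm.dualSubmodule_dualSubmodule_of_basis (R := ℤ) (B := innerₗ 𝔼) hB hs b

theorem exists_basis_span_eq (L : Submodule ℤ 𝔼) [DiscreteTopology L]
    (hL : span ℝ (L : Set 𝔼) = ⊤) : ∃ b : Basis (Fin n) ℝ 𝔼, span ℤ (Set.range b) = L := by
  obtain ⟨b, hb⟩ := exists_reduced_sequence L hL n (by simp)
  have hli := linearIndependent_of_notMem_span_Iio b fun i => (hb i).2.1
  have hspan : span ℝ (Set.range b) = ⊤ := hli.span_eq_top_of_card_eq_finrank' (by simp)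
  refine ⟨Basis.mk hli hspan.ge, ?_⟩
  rw [Basis.coe_mk]
  exact span_eq_of_reduced L b hspan hb

/-- In orthonormal coordinates the transposed matrix of `b'` is inverse to that of `b`. -/
theorem covolume_mul_covolume_of_dual (b b' : Basis (Fin n) ℝ 𝔼)
    (h : ∀ i j, inner ℝ (b' i) (b j) = if i = j then (1 : ℝ) else 0) :
    ZLattice.covolume (span ℤ (Set.range b)) * ZLattice.covolume (span ℤ (Set.range b')) = 1 := by
  let e := EuclideanSpace.basisFun (Fin n) ℝ
  rw [covolume_span_eq_abs_det b e, covolume_span_eq_abs_det b' e, ← abs_mul]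
  have : (e.toBasis.toMatrix b').transpose * e.toBasis.toMatrix b = 1 := by
    ext i j
    rw [Matrix.mul_apply, Matrix.one_apply, ← h i j, ← e.sum_inner_mul_inner]
    refine Finset.sum_congr rfl fun k _ => ?_
    simp [Basis.toMatrix_apply, e.repr_apply_apply, real_inner_comm]
  have h2 := congrArg Matrix.det this
  rw [Matrix.det_mul, Matrix.det_transpose, Matrix.det_one] at h2
  rw [Basis.det_apply, Basis.det_apply, mul_comm, h2, abs_one]

theorem covolume_sq_eq_det_gram (b : Basis (Fin n) ℝ 𝔼) :
    ZLattice.covolume (span ℤ (Set.range b)) ^ 2 = (Matrix.gram ℝ b).det := by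
  let e := EuclideanSpace.basisFun (Fin n) ℝ
  rw [covolume_span_eq_abs_det b e, sq_abs, Basis.det_apply]
  have : (e.toBasis.toMatrix b).transpose * e.toBasis.toMatrix b = Matrix.gram ℝ b := by
    ext i j
    rw [Matrix.mul_apply, Matrix.gram_apply, ← e.sum_inner_mul_inner]
    refine Finset.sum_congr rfl fun k _ => ?_
    simp [Basis.toMatrix_apply, e.repr_apply_apply, real_inner_comm]
  rw [← this, Matrix.det_mul, Matrix.det_transpose, sq]

/-- Triangular coordinates of a Korkine–Zolotareff reduced basis. -/
theorem exists_korkineZolotareff (L : Submodule ℤ 𝔼) [DiscreteTopology L]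
    (hL : span ℝ (L : Set 𝔼) = ⊤) :
    ∃ (b : Fin n → 𝔼) (e : OrthonormalBasis (Fin n) ℝ 𝔼), (∀ i, b i ∈ L) ∧
      (∀ i k, i < k → inner ℝ (e k) (b i) = 0) ∧ (∀ i, inner ℝ (e i) (b i) ≠ 0) ∧
      ZLattice.covolume L = |∏ i, inner ℝ (e i) (b i)| ∧
      ∀ x ∈ L, ∀ i k, i ≤ k → inner ℝ (e k) x ≠ 0 →
        inner ℝ (e i) (b i) ^ 2 ≤ ∑ j, if i ≤ j then inner ℝ (e j) x ^ 2 else 0 := by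
  obtain ⟨b, hb⟩ := exists_reduced_sequence L hL n (by simp)
  have hli := linearIndependent_of_notMem_span_Iio b fun i => (hb i).2.1
  have hfin : finrank ℝ 𝔼 = Fintype.card (Fin n) := by simp
  have hspan : span ℝ (Set.range b) = ⊤ := hli.span_eq_top_of_card_eq_finrank' (by simp)
  let B : Basis (Fin n) ℝ 𝔼 := Basis.mk hli hspan.ge
  have hBb : ⇑B = b := Basis.coe_mk hli _
  have hBL : span ℤ (Set.range b) = L := span_eq_of_reduced L b hspan hb
  let e := InnerProductSpace.gramSchmidtOrthonormalBasis hfin b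
  have htri : ∀ i k, i < k → inner ℝ (e k) (b i) = 0 := fun i k h =>
    InnerProductSpace.gramSchmidtOrthonormalBasis_inv_triangular hfin b h
  have hcov : ZLattice.covolume L = |∏ i, inner ℝ (e i) (b i)| := by
    rw [← InnerProductSpace.gramSchmidtOrthonormalBasis_det, ← hBL, ← hBb]
    exact covolume_span_eq_abs_det B _
  have hmem : ∀ i k, k < i → e k ∈ span ℝ (b '' Set.Iio i) := by
    intro i k hk
    have h1 : e k = InnerProductSpace.gramSchmidtNormed ℝ b k :=
      InnerProductSpace.gramSchmidtOrthonormalBasis_apply hfin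
        ((InnerProductSpace.gramSchmidtNormed_linearIndependent hli).ne_zero k)
    rw [h1, ← InnerProductSpace.span_gramSchmidt_Iio, ← InnerProductSpace.span_gramSchmidtNormed]
    exact subset_span ⟨k, hk, rfl⟩
  have hort : ∀ i k, i ≤ k → ∀ w ∈ span ℝ (b '' Set.Iio i), inner ℝ (e k) w = 0 := by
    intro i k hik w hw
    induction hw using span_induction with
    | mem w hw =>
      obtain ⟨j, hj, rfl⟩ := hw
      exact htri j k (lt_of_lt_of_le hj hik)
    | zero => simp
    | add x y _ _ hx hy => rw [inner_add_right, hx, hy, add_zero]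
    | smul c x _ hx => rw [inner_smul_right, hx, mul_zero]
  -- The Gram–Schmidt vectors before i lie in the span of the earlier basis vectors and the others
  -- are orthogonal to it, so the squared distance is the tail of the coordinate sum.
  have hproj : ∀ i x, ‖(span ℝ (b '' Set.Iio i))ᗮ.starProjection x‖ ^ 2 =
      ∑ j, if i ≤ j then inner ℝ (e j) x ^ 2 else 0 := by
    intro i x
    set W := span ℝ (b '' Set.Iio i)
    rw [← e.sum_sq_inner_right]
    refine Finset.sum_congr rfl fun j _ => ?_
    split_ifs with hij
    · rw [starProjection_orthogonal_val, inner_sub_right,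
        hort i j hij _ (W.starProjection_apply_mem x), sub_zero]
    · rw [sq_eq_zero_iff]
      exact (mem_orthogonal W _).1 (Wᗮ.starProjection_apply_mem x) _ (hmem i j (not_le.1 hij))
  have hdiag : ∀ i, (∑ j, if i ≤ j then inner ℝ (e j) (b i) ^ 2 else 0) =
      inner ℝ (e i) (b i) ^ 2 := by
    intro i
    rw [Finset.sum_eq_single i]
    · simp
    · intro j _ hj
      split_ifs with hij
      · rw [htri i j (lt_of_le_of_ne hij hj.symm), sq, mul_zero]
      · rfl
    · simp
  refine ⟨b, e, fun i => (hb i).1, htri, fun i => ?_, hcov, fun x hx i k hik hne => ?_⟩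
  · have : ∏ i, inner ℝ (e i) (b i) ≠ 0 := by
      have : IsZLattice ℝ L := ⟨hL⟩
      rw [← abs_ne_zero, ← hcov]
      exact ZLattice.covolume_ne_zero L
    exact Finset.prod_ne_zero_iff.1 this i (Finset.mem_univ i)
  · rw [← hdiag, ← hproj, ← hproj]
    -- A nonzero coordinate along `e k` with i ≤ k keeps x outside the span of the vectors before i.
    have := (hb i).2.2 x hx fun h => hne (hort i k hik x h)
    gcongr

end Covolume

/-! ### Hermite bounds in dimensions three and four -/

section HermiteBound

open Submodule

/-- The squared covolume is the product of the squared diagonal entries, at least 1 · 3/4 · 2/3 =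
1/2 times the cube of the first. -/
theorem pow_three_le_covolume (L : Submodule ℤ (EuclideanSpace ℝ (Fin 3))) [DiscreteTopology L]
    (hL : span ℝ (L : Set (EuclideanSpace ℝ (Fin 3))) = ⊤) {m : ℝ} (hm0 : 0 ≤ m)
    (hm : ∀ v ∈ L, v ≠ 0 → m ≤ ‖v‖ ^ 2) : m ^ 3 ≤ 2 * ZLattice.covolume L ^ 2 := by
  obtain ⟨b, e, hb, htri, hne, hcov, hmin⟩ := exists_korkineZolotareff L hL
  have t01 := htri 0 1 (by decide)
  have t02 := htri 0 2 (by decide)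
  have t12 := htri 1 2 (by decide)
  have hm1 : m ≤ inner ℝ (e 0) (b 0) ^ 2 := by
    have h := hm (b 0) (hb 0) (by rintro h; exact hne 0 (by simp [h]))
    rw [← e.sum_sq_inner_right, Fin.sum_univ_three, t01, t02] at h
    linarith
  have h1 : 3 / 4 * inner ℝ (e 0) (b 0) ^ 2 ≤ inner ℝ (e 1) (b 1) ^ 2 := by
    refine three_quarters_le_of_reduced (a := inner ℝ (e 0) (b 1)) (hne 0) fun x => ?_
    have := hmin (x • b 0 + b 1) (L.add_mem (L.smul_mem _ (hb 0)) (hb 1)) 0 1 (by decide)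
    simp only [← Int.cast_smul_eq_zsmul ℝ, inner_add_right, inner_smul_right, t01,
      Fin.sum_univ_three, t02, t12] at this
    simpa [hne 1] using this
  have h2 : 2 / 3 * inner ℝ (e 0) (b 0) ^ 2 ≤ inner ℝ (e 2) (b 2) ^ 2 := by
    refine two_thirds_le_of_korkineZolotareff (a := inner ℝ (e 0) (b 1)) (c := inner ℝ (e 0) (b 2))
      (d := inner ℝ (e 1) (b 2)) (hne 0) (hne 1) (fun x => ?_) (fun x y => ?_) fun y => ?_
    · have := hmin (x • b 0 + b 1) (L.add_mem (L.smul_mem _ (hb 0)) (hb 1)) 0 1 (by decide)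
      simp only [← Int.cast_smul_eq_zsmul ℝ, inner_add_right, inner_smul_right, t01,
        Fin.sum_univ_three, t02, t12] at this
      simpa [hne 1] using this
    · have := hmin (x • b 0 + y • b 1 + b 2) (L.add_mem (L.add_mem (L.smul_mem _ (hb 0))
        (L.smul_mem _ (hb 1))) (hb 2)) 0 2 (by decide)
      simp only [← Int.cast_smul_eq_zsmul ℝ, inner_add_right, inner_smul_right, t01,
        Fin.sum_univ_three, t02, t12] at this
      simpa [hne 2] using this
    · have := hmin (y • b 1 + b 2) (L.add_mem (L.smul_mem _ (hb 1)) (hb 2)) 1 2 (by decide)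
      simp only [← Int.cast_smul_eq_zsmul ℝ, inner_add_right, inner_smul_right,
        Fin.sum_univ_three, t12] at this
      simpa [hne 2] using this
  rw [hcov, sq_abs, Fin.prod_univ_three, mul_pow, mul_pow]
  set A := inner ℝ (e 0) (b 0) ^ 2
  calc m ^ 3 ≤ A ^ 3 := by gcongr
    _ = 2 * (A * (3 / 4 * A) * (2 / 3 * A)) := by ring
    _ ≤ _ := by gcongr

/-- The fourth entry is bounded by applying the two-dimensional estimate to the projection
orthogonal to the first two vectors: it is at least 3/4 · 2/3 = 1/2 of the first. The total factor
is 1 · 3/4 · 2/3 · 1/2 = 1/4. -/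
theorem pow_four_le_covolume (L : Submodule ℤ (EuclideanSpace ℝ (Fin 4))) [DiscreteTopology L]
    (hL : span ℝ (L : Set (EuclideanSpace ℝ (Fin 4))) = ⊤) {m : ℝ} (hm0 : 0 ≤ m)
    (hm : ∀ v ∈ L, v ≠ 0 → m ≤ ‖v‖ ^ 2) : m ^ 4 ≤ 4 * ZLattice.covolume L ^ 2 := by
  obtain ⟨b, e, hb, htri, hne, hcov, hmin⟩ := exists_korkineZolotareff L hL
  have t01 := htri 0 1 (by decide)
  have t02 := htri 0 2 (by decide)
  have t12 := htri 1 2 (by decide)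
  have t03 := htri 0 3 (by decide)
  have t13 := htri 1 3 (by decide)
  have t23 := htri 2 3 (by decide)
  have hm1 : m ≤ inner ℝ (e 0) (b 0) ^ 2 := by
    have h := hm (b 0) (hb 0) (by rintro h; exact hne 0 (by simp [h]))
    rw [← e.sum_sq_inner_right, Fin.sum_univ_four, t01, t02, t03] at h
    linarith
  have h1 : 3 / 4 * inner ℝ (e 0) (b 0) ^ 2 ≤ inner ℝ (e 1) (b 1) ^ 2 := by
    refine three_quarters_le_of_reduced (a := inner ℝ (e 0) (b 1)) (hne 0) fun x => ?_
    have := hmin (x • b 0 + b 1) (L.add_mem (L.smul_mem _ (hb 0)) (hb 1)) 0 1 (by decide)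
    simp only [← Int.cast_smul_eq_zsmul ℝ, inner_add_right, inner_smul_right, t01,
      Fin.sum_univ_four, t02, t12, t03, t13] at this
    simpa [hne 1] using this
  have h3 : 3 / 4 * inner ℝ (e 2) (b 2) ^ 2 ≤ inner ℝ (e 3) (b 3) ^ 2 := by
    refine three_quarters_le_of_reduced (a := inner ℝ (e 2) (b 3)) (hne 2) fun x => ?_
    have := hmin (x • b 2 + b 3) (L.add_mem (L.smul_mem _ (hb 2)) (hb 3)) 2 3 (by decide)
    simp only [← Int.cast_smul_eq_zsmul ℝ, inner_add_right, inner_smul_right,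
      Fin.sum_univ_four, t23] at this
    simpa [hne 3] using this
  have h2 : 2 / 3 * inner ℝ (e 0) (b 0) ^ 2 ≤ inner ℝ (e 2) (b 2) ^ 2 := by
    refine two_thirds_le_of_korkineZolotareff (a := inner ℝ (e 0) (b 1)) (c := inner ℝ (e 0) (b 2))
      (d := inner ℝ (e 1) (b 2)) (hne 0) (hne 1) (fun x => ?_) (fun x y => ?_) fun y => ?_
    · have := hmin (x • b 0 + b 1) (L.add_mem (L.smul_mem _ (hb 0)) (hb 1)) 0 1 (by decide)
      simp only [← Int.cast_smul_eq_zsmul ℝ, inner_add_right, inner_smul_right, t01,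
        Fin.sum_univ_four, t02, t12, t03, t13] at this
      simpa [hne 1] using this
    · have := hmin (x • b 0 + y • b 1 + b 2) (L.add_mem (L.add_mem (L.smul_mem _ (hb 0))
        (L.smul_mem _ (hb 1))) (hb 2)) 0 2 (by decide)
      simp only [← Int.cast_smul_eq_zsmul ℝ, inner_add_right, inner_smul_right, t01,
        Fin.sum_univ_four, t02, t12, t03, t13, t23] at this
      simpa [hne 2] using this
    · have := hmin (y • b 1 + b 2) (L.add_mem (L.smul_mem _ (hb 1)) (hb 2)) 1 2 (by decide)
      simp only [← Int.cast_smul_eq_zsmul ℝ, inner_add_right, inner_smul_right,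
        Fin.sum_univ_four, t12, t13, t23] at this
      simpa [hne 2] using this
  have h4 : 1 / 2 * inner ℝ (e 0) (b 0) ^ 2 ≤ inner ℝ (e 3) (b 3) ^ 2 := by linarith
  rw [hcov, sq_abs, Fin.prod_univ_four, mul_pow, mul_pow, mul_pow]
  set A := inner ℝ (e 0) (b 0) ^ 2
  calc m ^ 4 ≤ A ^ 4 := by gcongr
    _ = 4 * (A * (3 / 4 * A) * (2 / 3 * A) * (1 / 2 * A)) := by ring
    _ ≤ _ := by gcongr

end HermiteBound

/-! ### Fourier analysis of lattice-periodic functions -/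

section Fourier

open Submodule Module MeasureTheory

variable {n : ℕ}

local notation "𝔼" => EuclideanSpace ℝ (Fin n)

/-- The projection of Euclidean space to the standard torus in the coordinates of a basis. -/
noncomputable def torusProj (b : Basis (Fin n) ℝ 𝔼) (x : 𝔼) : UnitAddTorus (Fin n) :=
  fun i => (b.repr x i : UnitAddCircle)

theorem torusProj_add (b : Basis (Fin n) ℝ 𝔼) (x y : 𝔼) :
    torusProj b (x + y) = torusProj b x + torusProj b y := by
  ext i
  simp [torusProj]

theorem isOpenQuotientMap_torusProj (b : Basis (Fin n) ℝ 𝔼) :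
    IsOpenQuotientMap (torusProj b) := by
  have h1 : IsOpenQuotientMap (fun (t : Fin n → ℝ) i => (t i : UnitAddCircle)) :=
    IsOpenQuotientMap.piMap (f := fun (_ : Fin n) (t : ℝ) => (t : UnitAddCircle))
      fun _ => QuotientAddGroup.isOpenQuotientMap_mk
  have h2 : IsOpenQuotientMap b.equivFunL := b.equivFunL.toHomeomorph.isOpenQuotientMap
  exact h1.comp h2

theorem torusProj_eq_iff (b : Basis (Fin n) ℝ 𝔼) (x y : 𝔼) :
    torusProj b x = torusProj b y ↔ x - y ∈ span ℤ (Set.range b) := by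
  rw [b.mem_span_iff_repr_mem ℤ, funext_iff]
  refine forall_congr' fun i => ?_
  rw [torusProj, torusProj, ← sub_eq_zero, ← AddCircle.coe_sub, AddCircle.coe_eq_zero_iff]
  simp

/-- The function on the standard torus induced by a periodic function. -/
noncomputable def torusFun (b : Basis (Fin n) ℝ 𝔼) {F : Type*} (f : 𝔼 → F) :
    UnitAddTorus (Fin n) → F :=
  fun τ => f (Function.surjInv (isOpenQuotientMap_torusProj b).surjective τ)

/-- Invariance of a function under the lattice spanned by `b`. -/
def IsPeriodic (b : Basis (Fin n) ℝ 𝔼) {F : Type*} (f : 𝔼 → F) : Prop :=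
  ∀ x, ∀ l ∈ span ℤ (Set.range b), f (x + l) = f x

theorem torusFun_torusProj {b : Basis (Fin n) ℝ 𝔼} {F : Type*} {f : 𝔼 → F} (hf : IsPeriodic b f)
    (x : 𝔼) : torusFun b f (torusProj b x) = f x := by
  have h := (torusProj_eq_iff b _ x).1
    (Function.surjInv_eq (isOpenQuotientMap_torusProj b).surjective (torusProj b x))
  rw [torusFun, ← hf x _ h, add_sub_cancel]

theorem continuous_torusFun {b : Basis (Fin n) ℝ 𝔼} {F : Type*} [TopologicalSpace F] {f : 𝔼 → F}
    (hf : IsPeriodic b f) (hc : Continuous f) : Continuous (torusFun b f) := by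
  rw [(isOpenQuotientMap_torusProj b).isQuotientMap.continuous_iff]
  convert! hc using 1
  ext x
  exact torusFun_torusProj hf x

/-- The Haar probability measure of the standard torus. -/
noncomputable def torusMeasure (n : ℕ) : Measure (UnitAddTorus (Fin n)) :=
  Measure.pi fun _ => (AddCircle.haarAddCircle : Measure UnitAddCircle)

instance : IsProbabilityMeasure (torusMeasure n) := by
  unfold torusMeasure
  infer_instance

instance : (torusMeasure n).IsAddRightInvariant := by
  unfold torusMeasure
  infer_instance

theorem integrable_torusMeasure {f : UnitAddTorus (Fin n) → ℂ} (hf : Continuous f) :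
    Integrable f (torusMeasure n) :=
  hf.integrable_of_hasCompactSupport (HasCompactSupport.of_compactSpace f)

/-- The integral of a directional derivative over the torus vanishes. -/
theorem integral_torus_lineDeriv_eq_zero (b : Basis (Fin n) ℝ 𝔼) {g h : UnitAddTorus (Fin n) → ℂ}
    (hg : Continuous g) (hh : Continuous h) (v : 𝔼)
    (hd : ∀ x, HasDerivAt (fun s : ℝ => g (torusProj b (x + s • v))) (h (torusProj b x)) 0) :
    ∫ τ, h τ ∂torusMeasure n = 0 := by
  have hπ := (isOpenQuotientMap_torusProj b).continuous
  have hd' : ∀ x (s : ℝ), HasDerivAt (fun s : ℝ => g (torusProj b (x + s • v)))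
      (h (torusProj b (x + s • v))) s := by
    intro x s
    have h0 := hd (x + s • v)
    rw [← sub_self s] at h0
    have h1 := h0.comp_sub_const s s
    convert! h1 using 1
    ext t
    congr 2
    module
  -- Integrating h along a segment gives a difference of two translates of g, whose integral over
  -- the torus vanishes by invariance. After Fubini, invariance also makes the inner integral of h
  -- independent of s.
  have ftc : ∀ τ, ∫ s in (0 : ℝ)..1, h (τ + torusProj b (s • v)) = g (τ + torusProj b v) - g τ := by
    intro τ
    obtain ⟨x, rfl⟩ := (isOpenQuotientMap_torusProj b).surjective τ
    have h1 := intervalIntegral.integral_eq_sub_of_hasDerivAt (fun s _ => hd' x s)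
      (Continuous.intervalIntegrable (by fun_prop) 0 1)
    simpa [torusProj_add] using h1
  have hz : ∫ τ, (g (τ + torusProj b v) - g τ) ∂torusMeasure n = 0 := by
    rw [integral_sub (integrable_torusMeasure (by fun_prop)) (integrable_torusMeasure hg),
      integral_add_right_eq_self g, sub_self]
  simp_rw [← ftc] at hz
  have hcont : Continuous fun p : ℝ × UnitAddTorus (Fin n) => h (p.2 + torusProj b (p.1 • v)) := by
    fun_prop
  rw [← intervalIntegral_integral_swap] at hz
  · simpa [integral_add_right_eq_self h] using hz
  · obtain ⟨C, hC⟩ := isCompact_univ.exists_bound_of_continuousOn hh.continuousOn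
    have : IsFiniteMeasure (volume.restrict (Set.uIoc (0 : ℝ) 1)) := by
      rw [Set.uIoc_of_le zero_le_one]
      infer_instance
    exact Integrable.of_bound hcont.aestronglyMeasurable C (.of_forall fun p => hC _ trivial)

/-- The character `u ↦ e^{2πi⟨ξ,u⟩}`. -/
noncomputable def expInner (ξ u : 𝔼) : ℂ :=
  Complex.exp (2 * π * Complex.I * ((inner ℝ ξ u : ℝ) : ℂ))

theorem contDiff_expInner (ξ : 𝔼) : ContDiff ℝ ∞ (expInner ξ) := by
  have h : ContDiff ℝ ∞ fun u : 𝔼 => ((inner ℝ ξ u : ℝ) : ℂ) :=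
    Complex.ofRealCLM.contDiff.comp (innerSL ℝ ξ).contDiff
  exact (contDiff_const.mul h).cexp

theorem fderiv_expInner (ξ u v : 𝔼) :
    fderiv ℝ (expInner ξ) u v = 2 * π * Complex.I * ((inner ℝ ξ v : ℝ) : ℂ) * expInner ξ u := by
  have h : HasFDerivAt (fun u : 𝔼 => ((inner ℝ ξ u : ℝ) : ℂ))
      (Complex.ofRealCLM.comp (innerSL ℝ ξ)) u :=
    Complex.ofRealCLM.hasFDerivAt.comp u (innerSL ℝ ξ).hasFDerivAt
  have h2 := (h.const_mul (2 * π * Complex.I)).cexp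
  have h3 : HasFDerivAt (expInner ξ) _ u := h2
  rw [h3.fderiv]
  simp [expInner]
  ring

theorem norm_expInner (ξ u : 𝔼) : ‖expInner ξ u‖ = 1 := by
  rw [expInner, show (2 * π * Complex.I * ((inner ℝ ξ u : ℝ) : ℂ)) =
    ((2 * π * inner ℝ ξ u : ℝ) : ℂ) * Complex.I by push_cast; ring, Complex.norm_exp_ofReal_mul_I]

theorem expInner_add_of_mem_dual {L : Submodule ℤ 𝔼} {ξ : 𝔼} (hξ : ξ ∈ dualLattice L) (u : 𝔼)
    {l : 𝔼} (hl : l ∈ L) : expInner ξ (u + l) = expInner ξ u := by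
  obtain ⟨m, hm⟩ := Submodule.mem_one.1 (hξ l hl)
  have hm' : inner ℝ ξ l = (m : ℝ) := by simpa using hm.symm
  rw [expInner, inner_add_right, hm', Complex.ofReal_add, mul_add, Complex.exp_add]
  have : Complex.exp (2 * π * Complex.I * ((m : ℝ) : ℂ)) = 1 := by
    rw [Complex.exp_eq_one_iff]
    exact ⟨m, by push_cast; ring⟩
  rw [this, mul_one, expInner]

theorem laplacian_eq_sum_fderiv {F : Type*} [NormedAddCommGroup F] [NormedSpace ℝ F] {f : 𝔼 → F}
    (hf : ContDiff ℝ 2 f) (e : OrthonormalBasis (Fin n) ℝ 𝔼) (x : 𝔼) :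
    (Δ f) x = ∑ i, fderiv ℝ (fun y => fderiv ℝ f y (e i)) x (e i) := by
  rw [InnerProductSpace.laplacian_eq_iteratedFDeriv_orthonormalBasis f e]
  refine Finset.sum_congr rfl fun i _ => ?_
  rw [iteratedFDeriv_two_apply]
  have hd : DifferentiableAt ℝ (fderiv ℝ f) x :=
    (hf.fderiv_right (m := 1) (by norm_num)).differentiable (by norm_num) x
  rw [fderiv_clm_apply hd (by fun_prop)]
  simp

theorem laplacian_expInner (ξ u : 𝔼) :
    (Δ (expInner ξ)) u = -((4 * π ^ 2 * ‖ξ‖ ^ 2 : ℝ) : ℂ) * expInner ξ u := by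
  let e := EuclideanSpace.basisFun (Fin n) ℝ
  rw [laplacian_eq_sum_fderiv ((contDiff_expInner ξ).of_le (by norm_cast)) e]
  have h : ∀ i, fderiv ℝ (fun y => fderiv ℝ (expInner ξ) y (e i)) u (e i) =
      -((4 * π ^ 2 * inner ℝ ξ (e i) ^ 2 : ℝ) : ℂ) * expInner ξ u := by
    intro i
    simp_rw [fderiv_expInner]
    rw [fderiv_const_mul ((contDiff_expInner ξ).differentiable (by norm_num) u)]
    simp only [smul_apply, fderiv_expInner, smul_eq_mul]
    push_cast
    linear_combination (4 * π ^ 2 * (inner ℝ ξ (e i) : ℂ) ^ 2 * expInner ξ u) * Complex.I_sq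
  simp_rw [h]
  rw [← Finset.sum_mul, ← e.sum_sq_inner_left]
  push_cast
  rw [Finset.mul_sum, Finset.sum_neg_distrib]

/-- Identifies the standard Fourier modes with the characters of the dual lattice, k being the
coordinates in the dual basis. -/
theorem mFourier_torusProj (b b' : Basis (Fin n) ℝ 𝔼)
    (hb : ∀ i j, inner ℝ (b' i) (b j) = if i = j then (1 : ℝ) else 0) (k : Fin n → ℤ) (x : 𝔼) :
    UnitAddTorus.mFourier k (torusProj b x) =
      expInner (∑ i, k i • b' i) x := by
  have h1 (c : Fin n → ℝ) (i : Fin n) : inner ℝ (b' i) (∑ j, c j • b j) = c i := by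
    simp [inner_sum, inner_smul_right, hb]
  have hx : inner ℝ (∑ i, k i • b' i) x = ∑ i, (k i : ℝ) * b.repr x i := by
    rw [sum_inner]
    refine Finset.sum_congr rfl fun i _ => ?_
    conv_lhs => rw [← b.sum_repr x, ← Int.cast_smul_eq_zsmul ℝ, inner_smul_left, h1]
    simp
  rw [expInner, hx]
  simp only [UnitAddTorus.mFourier, ContinuousMap.coe_mk, torusProj, fourier_coe_apply,
    ← Complex.exp_sum]
  congr 1
  push_cast
  rw [Finset.mul_sum]
  refine Finset.sum_congr rfl fun i _ => ?_
  simp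
  ring

theorem IsPeriodic.fderiv {b : Basis (Fin n) ℝ 𝔼} {f : 𝔼 → ℂ} (hf : IsPeriodic b f) (v : 𝔼) :
    IsPeriodic b fun x => fderiv ℝ f x v := by
  intro x l hl
  have h : (fun y => f (y + l)) = f := funext fun y => hf y l hl
  change _root_.fderiv ℝ f (x + l) v = _root_.fderiv ℝ f x v
  rw [← fderiv_comp_add_right, h]

/-- The Fourier coefficient of a periodic function. -/
noncomputable def periodicCoeff (b : Basis (Fin n) ℝ 𝔼) (f : 𝔼 → ℂ) (k : Fin n → ℤ) : ℂ :=
  ∫ τ, UnitAddTorus.mFourier (-k) τ * torusFun b f τ ∂torusMeasure n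

/-- Integration by parts: the derivative of the product of f with the conjugate mode integrates to
zero. -/
theorem periodicCoeff_fderiv (b b' : Basis (Fin n) ℝ 𝔼)
    (hb : ∀ i j, inner ℝ (b' i) (b j) = if i = j then (1 : ℝ) else 0) {f : 𝔼 → ℂ}
    (hf : IsPeriodic b f) (hc : ContDiff ℝ 1 f) (k : Fin n → ℤ) (v : 𝔼) :
    periodicCoeff b (fun x => fderiv ℝ f x v) k =
      2 * π * Complex.I * ((inner ℝ (∑ i, k i • b' i) v : ℝ) : ℂ) * periodicCoeff b f k := by
  set ξ := ∑ i, k i • b' i with hξ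
  have hc' : Continuous fun x => fderiv ℝ f x v := by fun_prop
  have hF := continuous_torusFun hf hc.continuous
  have hF' := continuous_torusFun (hf.fderiv v) hc'
  have hm := (UnitAddTorus.mFourier (-k)).continuous
  have key := integral_torus_lineDeriv_eq_zero b
    (g := fun τ => UnitAddTorus.mFourier (-k) τ * torusFun b f τ)
    (h := fun τ => UnitAddTorus.mFourier (-k) τ * torusFun b (fun x => fderiv ℝ f x v) τ -
      2 * π * Complex.I * ((inner ℝ ξ v : ℝ) : ℂ) * (UnitAddTorus.mFourier (-k) τ * torusFun b f τ))
    (by fun_prop) (by fun_prop) v fun x => by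
      simp only [torusFun_torusProj hf, torusFun_torusProj (hf.fderiv v),
        mFourier_torusProj b b' hb]
      have hξ' : ∑ i, (-k) i • b' i = -ξ := by simp [hξ]
      rw [hξ']
      have hline : HasDerivAt (fun s : ℝ => x + s • v) v 0 := by
        simpa using ((hasDerivAt_id (0 : ℝ)).smul_const v).const_add x
      have h1 : HasDerivAt (fun s : ℝ => expInner (-ξ) (x + s • v))
          (fderiv ℝ (expInner (-ξ)) x v) 0 :=
        HasFDerivAt.comp_hasDerivAt_of_eq (0 : ℝ)
          ((contDiff_expInner (-ξ)).differentiable (by norm_num) x).hasFDerivAt hline (by simp)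
      have h2 : HasDerivAt (fun s : ℝ => f (x + s • v)) (fderiv ℝ f x v) 0 :=
        HasFDerivAt.comp_hasDerivAt_of_eq (0 : ℝ)
          (hc.differentiable (by norm_num) x).hasFDerivAt hline (by simp)
      convert! h1.mul h2 using 1
      rw [fderiv_expInner, inner_neg_left]
      simp
      ring
  rw [integral_sub (integrable_torusMeasure (by fun_prop)) (integrable_torusMeasure (by fun_prop)),
    integral_const_mul, sub_eq_zero] at key
  exact key

/-- If all coefficients vanished, the Fourier series would be trivially summable, hence would
converge pointwise to f, forcing f = 0. -/
theorem exists_periodicCoeff_ne_zero (b : Basis (Fin n) ℝ 𝔼) {f : 𝔼 → ℂ}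
    (hf : IsPeriodic b f) (hc : Continuous f) (h0 : f ≠ 0) : ∃ k, periodicCoeff b f k ≠ 0 := by
  by_contra! h
  apply h0
  let F : C(UnitAddTorus (Fin n), ℂ) := ⟨torusFun b f, continuous_torusFun hf hc⟩
  have hF : UnitAddTorus.mFourierCoeff F = 0 := funext h
  ext x
  have h1 := UnitAddTorus.hasSum_mFourier_series_apply_of_summable (f := F)
    (by rw [hF]; exact summable_zero) (torusProj b x)
  rw [hF] at h1
  simp only [Pi.zero_apply, zero_smul] at h1
  have h2 := h1.unique hasSum_zero
  rw [Pi.zero_apply, ← torusFun_torusProj hf x]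
  exact h2

/-- The eigenvalues of the Laplacian on periodic functions come from dual lattice vectors. -/
theorem exists_dual_of_laplacian_eq (b : Basis (Fin n) ℝ 𝔼) {f : 𝔼 → ℂ}
    (hf : IsPeriodic b f) (hc : ContDiff ℝ 2 f) (h0 : f ≠ 0) {κ : ℝ}
    (hκ : ∀ x, (Δ f) x = -(κ : ℂ) * f x) :
    ∃ ξ ∈ dualLattice (span ℤ (Set.range b)), κ = 4 * π ^ 2 * ‖ξ‖ ^ 2 := by
  obtain ⟨b', hb, hdual, -⟩ := dualLattice_span_eq b
  obtain ⟨k, hk⟩ := exists_periodicCoeff_ne_zero b hf hc.continuous h0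
  refine ⟨∑ i, k i • b' i, ?_, ?_⟩
  · rw [hdual]
    exact sum_mem fun i _ => smul_mem _ _ (subset_span ⟨i, rfl⟩)
  set ξ := ∑ i, k i • b' i with hξ
  let e := EuclideanSpace.basisFun (Fin n) ℝ
  have hc1 (v : 𝔼) : ContDiff ℝ 1 fun x => fderiv ℝ f x v :=
    (hc.fderiv_right (m := 1) (by norm_num)).clm_apply contDiff_const
  have h1 : ∀ i, periodicCoeff b (fun x => fderiv ℝ (fun y => fderiv ℝ f y (e i)) x (e i)) k =
      -((4 * π ^ 2 * inner ℝ ξ (e i) ^ 2 : ℝ) : ℂ) * periodicCoeff b f k := by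
    intro i
    rw [periodicCoeff_fderiv b b' hb (hf.fderiv (e i)) (hc1 (e i)),
      periodicCoeff_fderiv b b' hb hf (hc.of_le (by norm_num))]
    push_cast
    linear_combination (4 * π ^ 2 * (inner ℝ ξ (e i) : ℂ) ^ 2 * periodicCoeff b f k) * Complex.I_sq
  have hcont : ∀ i, Continuous
      (torusFun b fun x => fderiv ℝ (fun y => fderiv ℝ f y (e i)) x (e i)) := fun i =>
    continuous_torusFun ((hf.fderiv (e i)).fderiv (e i))
      (((hc1 (e i)).continuous_fderiv (by norm_num)).clm_apply continuous_const)
  -- The k-th coefficient of Δf is computed twice, from two integrations by parts and from the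
  -- eigenvalue equation. As that of f is nonzero, the factors agree.
  have h2 : periodicCoeff b (Δ f) k = -((4 * π ^ 2 * ‖ξ‖ ^ 2 : ℝ) : ℂ) * periodicCoeff b f k := by
    have h3 : periodicCoeff b (Δ f) k =
        ∑ i, periodicCoeff b (fun x => fderiv ℝ (fun y => fderiv ℝ f y (e i)) x (e i)) k := by
      have hint (i : Fin n) : Integrable (fun τ => UnitAddTorus.mFourier (-k) τ *
          torusFun b (fun x => fderiv ℝ (fun y => fderiv ℝ f y (e i)) x (e i)) τ)
          (torusMeasure n) :=
        integrable_torusMeasure ((UnitAddTorus.mFourier (-k)).continuous.mul (hcont i))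
      simp only [periodicCoeff]
      rw [← integral_finsetSum _ fun i _ => hint i]
      refine integral_congr_ae (.of_forall fun τ => ?_)
      simp only [torusFun, laplacian_eq_sum_fderiv hc e, Finset.mul_sum]
    rw [h3]
    simp_rw [h1]
    rw [← Finset.sum_mul, ← e.sum_sq_inner_left]
    push_cast
    rw [Finset.mul_sum, Finset.sum_neg_distrib]
  have h3 : periodicCoeff b (Δ f) k = -(κ : ℂ) * periodicCoeff b f k := by
    simp only [periodicCoeff]
    rw [← integral_const_mul]
    refine integral_congr_ae (.of_forall fun τ => ?_)
    simp only [torusFun, hκ]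
    ring
  have h4 := mul_right_cancel₀ hk (h3.symm.trans h2)
  exact_mod_cast neg_injective h4

end Fourier

/-! ### Spectrum of a flat torus and the minimality criterion -/

namespace FlatTorus

open Submodule Module

variable {n : ℕ} (T : FlatTorus n)

local notation "𝔼" => EuclideanSpace ℝ (Fin n)

instance : DiscreteTopology T.lattice := T.discrete

instance : IsZLattice ℝ T.lattice := ⟨T.span_eq_top⟩

theorem proj_surjective : Function.Surjective T.proj := T.lattice.mkQ_surjective

theorem proj_add_of_mem (u : 𝔼) {l : 𝔼} (hl : l ∈ T.lattice) : T.proj (u + l) = T.proj u :=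
  (Submodule.Quotient.eq T.lattice).2 (by rwa [add_sub_cancel_left])

/-- The map on the torus induced by a periodic map. -/
noncomputable def descend {F : Type*} (f : 𝔼 → F) : T.Carrier → F :=
  fun p => f (Function.surjInv T.proj_surjective p)

theorem descend_proj {F : Type*} {f : 𝔼 → F} (hf : ∀ u, ∀ l ∈ T.lattice, f (u + l) = f u) (u : 𝔼) :
    T.descend f (T.proj u) = f u := by
  have h : Function.surjInv T.proj_surjective (T.proj u) - u ∈ T.lattice :=
    (Submodule.Quotient.eq T.lattice).1 (Function.surjInv_eq T.proj_surjective (T.proj u))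
  rw [descend, ← hf u _ h, add_sub_cancel]

theorem descend_comp_proj {F : Type*} {f : 𝔼 → F} (hf : ∀ u, ∀ l ∈ T.lattice, f (u + l) = f u) :
    T.descend f ∘ T.proj = f :=
  funext (T.descend_proj hf)

/-- The eigenfunction is cos 2π⟨ξ,u⟩, which is nonzero at the origin. -/
theorem isEigenvalue_of_mem_dual {ξ : 𝔼} (hξ : ξ ∈ dualLattice T.lattice) :
    T.IsEigenvalue (4 * π ^ 2 * ‖ξ‖ ^ 2 / T.scale) := by
  have hper : ∀ u, ∀ l ∈ T.lattice, (Complex.reCLM ∘ expInner ξ) (u + l) =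
      (Complex.reCLM ∘ expInner ξ) u := fun u l hl => by
    rw [Function.comp_apply, expInner_add_of_mem_dual hξ u hl, Function.comp_apply]
  refine ⟨T.descend (Complex.reCLM ∘ expInner ξ), ?_, ?_, fun u => ?_⟩
  · rw [IsSmooth, T.descend_comp_proj hper]
    exact Complex.reCLM.contDiff.comp (contDiff_expInner ξ)
  · intro h
    have h1 := congrFun h (T.proj 0)
    rw [T.descend_proj hper] at h1
    simp [expInner] at h1
  · have hd : ContDiffAt ℝ 2 (expInner ξ) u :=
      (contDiff_expInner ξ).contDiffAt.of_le (by norm_cast)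
    rw [laplaceBeltrami, T.descend_comp_proj hper, T.descend_proj hper,
      hd.laplacian_CLM_comp_left, Function.comp_apply, laplacian_expInner, smul_eq_mul,
      Function.comp_apply]
    rw [← Complex.ofReal_neg, Complex.reCLM_apply, Complex.re_ofReal_mul, Complex.reCLM_apply]
    ring

theorem exists_mem_dual_of_isEigenvalue {μ : ℝ} (h : T.IsEigenvalue μ) :
    ∃ ξ ∈ dualLattice T.lattice, μ = 4 * π ^ 2 * ‖ξ‖ ^ 2 / T.scale := by
  obtain ⟨f, hs, h0, hf⟩ := h
  obtain ⟨b, hb⟩ := exists_basis_span_eq T.lattice T.span_eq_top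
  have hs2 : ContDiff ℝ 2 (f ∘ T.proj) := hs.of_le (by norm_cast)
  have hscale := T.scale_pos.ne'
  obtain ⟨ξ, hξ, hμ⟩ := exists_dual_of_laplacian_eq b (f := Complex.ofRealCLM ∘ (f ∘ T.proj))
    (κ := T.scale * μ)
    (fun x l hl => by
      rw [hb] at hl
      simp only [Function.comp_apply, T.proj_add_of_mem x hl])
    (Complex.ofRealCLM.contDiff.comp hs2)
    (fun hz => h0 (by
      ext p
      obtain ⟨u, rfl⟩ := T.proj_surjective p
      simpa using congrFun hz u))
    (fun x => by
      rw [hs2.contDiffAt.laplacian_CLM_comp_left]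
      have h1 := hf x
      rw [laplaceBeltrami, smul_eq_mul, inv_mul_eq_iff_eq_mul₀ hscale] at h1
      simp only [Function.comp_apply, h1, Complex.ofRealCLM_apply]
      push_cast
      ring)
  rw [hb] at hξ
  exact ⟨ξ, hξ, by rw [← hμ]; field_simp⟩

theorem isLeast_positiveSpectrum {m : ℝ}
    (hm : IsLeast {r | ∃ v ∈ dualLattice T.lattice, v ≠ 0 ∧ r = ‖v‖ ^ 2} m) :
    IsLeast T.positiveSpectrum (4 * π ^ 2 * m / T.scale) := by
  have hs := T.scale_pos
  obtain ⟨⟨ξ, hξ, hξ0, rfl⟩, hmin⟩ := hm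
  have hξ' := norm_pos_iff.2 hξ0
  refine ⟨⟨by positivity, T.isEigenvalue_of_mem_dual hξ⟩, ?_⟩
  rintro μ ⟨hμ, hev⟩
  obtain ⟨ζ, hζ, rfl⟩ := T.exists_mem_dual_of_isEigenvalue hev
  have hζ0 : ζ ≠ 0 := by
    rintro rfl
    simp at hμ
  have := hmin ⟨ζ, hζ, hζ0, rfl⟩
  gcongr

theorem lambdaOne_eq {m : ℝ}
    (hm : IsLeast {r | ∃ v ∈ dualLattice T.lattice, v ≠ 0 ∧ r = ‖v‖ ^ 2} m) :
    T.lambdaOne = 4 * π ^ 2 * m / T.scale :=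
  (T.isLeast_positiveSpectrum hm).csInf_eq

/-- The factor `scale` enters V^{2/n} to the first power and cancels against λ₁. -/
theorem functional_eq {m : ℝ} (hn : n ≠ 0)
    (hm : IsLeast {r | ∃ v ∈ dualLattice T.lattice, v ≠ 0 ∧ r = ‖v‖ ^ 2} m) :
    T.functional = 4 * π ^ 2 * (m * ZLattice.covolume T.lattice ^ ((2 : ℝ) / n)) := by
  have hs := T.scale_pos
  have hn' : (n : ℝ) ≠ 0 := by exact_mod_cast hn
  rw [functional, T.lambdaOne_eq hm, FlatTorus.volume,
    Real.mul_rpow (by positivity) (ZLattice.covolume_pos _ _).le, ← Real.rpow_mul hs.le]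
  rw [show (n : ℝ) / 2 * (2 / n) = 1 by field_simp, Real.rpow_one]
  field_simp

/-- The dual lattice of the lattice of a torus. -/
theorem exists_dual_basis : ∃ b : Basis (Fin n) ℝ 𝔼,
    dualLattice T.lattice = span ℤ (Set.range b) ∧
      ZLattice.covolume T.lattice * ZLattice.covolume (span ℤ (Set.range b)) = 1 := by
  obtain ⟨b, hb⟩ := exists_basis_span_eq T.lattice T.span_eq_top
  obtain ⟨b', hb', hdual, -⟩ := dualLattice_span_eq b
  exact ⟨b', by rw [← hb, hdual], by rw [← hb, covolume_mul_covolume_of_dual b b' hb']⟩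

theorem exists_isLeast_dual (hn : n ≠ 0) :
    ∃ m, IsLeast {r | ∃ v ∈ dualLattice T.lattice, v ≠ 0 ∧ r = ‖v‖ ^ 2} m := by
  obtain ⟨b, hb, -⟩ := T.exists_dual_basis
  rw [hb]
  exact exists_shortest_vector _ ⟨b ⟨0, Nat.pos_of_ne_zero hn⟩, subset_span ⟨_, rfl⟩, b.ne_zero _⟩

/-- Ensures that the infimum defining `lambdaOne` is attained and is not the default value of
`sInf`. -/
theorem isLeast_lambdaOne (hn : n ≠ 0) : IsLeast T.positiveSpectrum T.lambdaOne := by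
  obtain ⟨m, hm⟩ := T.exists_isLeast_dual hn
  rw [T.lambdaOne_eq hm]
  exact T.isLeast_positiveSpectrum hm

/-- The dilation-invariant functional is bounded by the Hermite constant. -/
theorem functional_le {γ : ℝ} (hn : n ≠ 0) (hγ : γ ∈ upperBounds (hermiteInvariants n)) :
    T.functional ≤ 4 * π ^ 2 * γ := by
  obtain ⟨m, hm⟩ := T.exists_isLeast_dual hn
  obtain ⟨b, hb, hcov⟩ := T.exists_dual_basis
  rw [T.functional_eq hn hm]
  gcongr
  refine hγ ⟨span ℤ (Set.range b), inferInstance, ?_, m, hb ▸ hm, ?_⟩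
  · rw [span_span_of_tower]
    exact b.span_eq
  · rw [eq_inv_of_mul_eq_one_left hcov, Real.inv_rpow (ZLattice.covolume_pos _ _).le]
    exact (div_eq_mul_inv _ _).symm

/-- A family of characters with frequencies of minimal length whose weighted frequencies form a
tight frame is a `λ₁`-minimal immersion. -/
theorem isLambdaOneMinimal_of_frame {N : ℕ} (c : Fin N → ℝ) (ξ : Fin N → 𝔼)
    {x : T.Carrier → EuclideanSpace ℂ (Fin N)}
    (hx : ∀ u j, x (T.proj u) j = (c j : ℂ) * expInner (ξ j) u)
    (hc : ∑ j, c j ^ 2 = 1)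
    (hframe : ∀ v, 4 * π ^ 2 * ∑ j, c j ^ 2 * inner ℝ (ξ j) v ^ 2 = T.scale * ‖v‖ ^ 2)
    (hξ : ∀ j, T.lambdaOne = 4 * π ^ 2 * ‖ξ j‖ ^ 2 / T.scale) : T.IsLambdaOneMinimal x := by
  have hs := T.scale_pos
  let p (j : Fin N) : EuclideanSpace ℂ (Fin N) →L[ℝ] ℂ :=
    (EuclideanSpace.proj j : EuclideanSpace ℂ (Fin N) →L[ℂ] ℂ).restrictScalars ℝ
  have hcomp (j : Fin N) : p j ∘ (x ∘ T.proj) = (c j : ℂ) • expInner (ξ j) :=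
    funext fun u => hx u j
  have hsmooth : ContDiff ℝ ∞ (x ∘ T.proj) := by
    rw [contDiff_piLp]
    intro j
    change ContDiff ℝ ∞ (p j ∘ (x ∘ T.proj))
    rw [hcomp]
    exact contDiff_const.mul (contDiff_expInner (ξ j))
  have hlap : ∀ u, T.laplaceBeltrami x u = -(T.lambdaOne • x (T.proj u)) := by
    intro u
    ext j
    have h1 := (hsmooth.contDiffAt (x := u)).of_le (show (2 : WithTop ℕ∞) ≤ ∞ by norm_cast)
      |>.laplacian_CLM_comp_left (l := p j)
    have h2 : ((Δ (x ∘ T.proj)) u) j = (c j : ℂ) *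
        (-((4 * π ^ 2 * ‖ξ j‖ ^ 2 : ℝ) : ℂ) * expInner (ξ j) u) := by
      rw [← laplacian_expInner]
      refine h1.symm.trans ?_
      rw [hcomp]
      let l : ℂ →L[ℝ] ℂ := (ContinuousLinearMap.mul ℝ ℂ) (c j : ℂ)
      exact ((contDiff_expInner (ξ j)).contDiffAt.of_le
        (show (2 : WithTop ℕ∞) ≤ ∞ by norm_cast)).laplacian_CLM_comp_left (l := l)
    rw [laplaceBeltrami, PiLp.smul_apply, h2, PiLp.neg_apply, PiLp.smul_apply, hx, hξ j]
    simp only [Complex.real_smul]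
    push_cast
    ring
  refine ⟨hsmooth, fun q => ?_, fun u v => ?_, fun u w hw => ?_, hlap⟩
  · obtain ⟨u, rfl⟩ := T.proj_surjective q
    rw [← sq_eq_sq₀ (norm_nonneg _) zero_le_one, EuclideanSpace.norm_sq_eq, one_pow, ← hc]
    refine Finset.sum_congr rfl fun j _ => ?_
    rw [hx, norm_mul, norm_expInner, mul_one, Complex.norm_real, Real.norm_eq_abs, sq_abs]
  · rw [EuclideanSpace.norm_sq_eq, ← hframe, Finset.mul_sum]
    refine Finset.sum_congr rfl fun j _ => ?_
    have h1 : (fderiv ℝ (x ∘ T.proj) u v) j =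
        (c j : ℂ) * (2 * π * Complex.I * ((inner ℝ (ξ j) v : ℝ) : ℂ) * expInner (ξ j) u) := by
      have h2 := (p j).hasFDerivAt.comp u (hsmooth.differentiable (by norm_num) u).hasFDerivAt
      rw [hcomp] at h2
      have h3 := ((contDiff_expInner (ξ j)).differentiable (by norm_num) u).hasFDerivAt.const_mul
        (c j : ℂ)
      rw [← fderiv_expInner]
      exact congrArg (fun A : 𝔼 →L[ℝ] ℂ => A v) (h2.unique h3)
    rw [h1]
    simp only [norm_mul, norm_expInner, Complex.norm_real, Complex.norm_I, Complex.norm_ofNat,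
      Real.norm_eq_abs, mul_pow, sq_abs]
    ring
  -- The Laplacian of x is a multiple of x itself, hence normal to the sphere.
  · rw [hlap, inner_neg_left, real_inner_smul_left, hw, mul_zero, neg_zero]

end FlatTorus

/-! ### Hermite constants from above, and tools for explicit lattices -/

open Submodule Module

theorem hermiteInvariants_three_le :
    (2 : ℝ) ^ ((1 : ℝ) / 3) ∈ upperBounds (hermiteInvariants 3) := by
  rintro _ ⟨L, hd, hs, m, ⟨⟨v, -, -, rfl⟩, hm⟩, rfl⟩
  have : IsZLattice ℝ L := ⟨hs⟩
  have hc := ZLattice.covolume_pos L MeasureTheory.volume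
  have h := pow_three_le_covolume L hs (sq_nonneg ‖v‖) fun w hw hw0 => hm ⟨w, hw, hw0, rfl⟩
  set c := ZLattice.covolume L
  rw [div_le_iff₀ (by positivity)]
  calc ‖v‖ ^ 2 = ((‖v‖ ^ 2) ^ 3) ^ ((1 : ℝ) / 3) := by
        rw [← Real.rpow_natCast (‖v‖ ^ 2) 3, ← Real.rpow_mul (by positivity)]
        norm_num
    _ ≤ (2 * c ^ 2) ^ ((1 : ℝ) / 3) := by gcongr
    _ = _ := by
        rw [Real.mul_rpow (by norm_num) (by positivity), ← Real.rpow_natCast c 2,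
          ← Real.rpow_mul hc.le]
        norm_num

theorem hermiteInvariants_four_le : √2 ∈ upperBounds (hermiteInvariants 4) := by
  rintro _ ⟨L, hd, hs, m, ⟨⟨v, -, -, rfl⟩, hm⟩, rfl⟩
  have : IsZLattice ℝ L := ⟨hs⟩
  have hc := ZLattice.covolume_pos L MeasureTheory.volume
  have h := pow_four_le_covolume L hs (sq_nonneg ‖v‖) fun w hw hw0 => hm ⟨w, hw, hw0, rfl⟩
  set c := ZLattice.covolume L
  have hexp : (2 : ℝ) / (4 : ℕ) = 1 / 2 := by norm_num
  rw [hexp, ← Real.sqrt_eq_rpow, div_le_iff₀ (Real.sqrt_pos.2 hc), ← Real.sqrt_mul (by norm_num)]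
  apply Real.le_sqrt_of_sq_le
  rw [← abs_of_nonneg (by positivity : 0 ≤ 2 * c), ← abs_of_nonneg (by positivity : 0 ≤ (‖v‖ ^ 2) ^ 2),
    ← sq_le_sq]
  linarith

theorem real_inner_eq_sum {n : ℕ} (x y : EuclideanSpace ℝ (Fin n)) :
    inner ℝ x y = ∑ i, x i * y i := by
  simp [PiLp.inner_apply, mul_comm]

theorem mem_dualLattice_span {n : ℕ} {S : Set (EuclideanSpace ℝ (Fin n))}
    {ξ : EuclideanSpace ℝ (Fin n)} :
    ξ ∈ dualLattice (span ℤ S) ↔ ∀ v ∈ S, ∃ k : ℤ, inner ℝ ξ v = (k : ℝ) := by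
  have h : ∀ v, inner ℝ ξ v ∈ (1 : Submodule ℤ ℝ) ↔ ∃ k : ℤ, inner ℝ ξ v = (k : ℝ) := by
    intro v
    simp [Submodule.mem_one, eq_comm]
  constructor
  · exact fun hξ v hv => (h v).1 (hξ v (subset_span hv))
  · intro hξ v hv
    change inner ℝ ξ v ∈ (1 : Submodule ℤ ℝ)
    induction hv using span_induction with
    | mem v hv => exact (h v).2 (hξ v hv)
    | zero => rw [inner_zero_right]; exact zero_mem _
    | add x y _ _ hx hy => rw [inner_add_right]; exact add_mem hx hy
    | smul k x _ hx =>
      rw [← Int.cast_smul_eq_zsmul ℝ, inner_smul_right, ← zsmul_eq_mul]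
      exact smul_mem _ _ hx

/-- The coefficients of a linear relation lie in the kernel of the Gram matrix. -/
theorem linearIndependent_of_det_gram_ne_zero {n : ℕ} {v : Fin n → EuclideanSpace ℝ (Fin n)}
    (h : (Matrix.gram ℝ v).det ≠ 0) : LinearIndependent ℝ v := by
  rw [Fintype.linearIndependent_iff]
  intro g hg
  have hz : (Matrix.gram ℝ v).mulVec g = 0 := by
    ext i
    have : inner ℝ (v i) (∑ j, g j • v j) = 0 := by rw [hg, inner_zero_right]
    rw [inner_sum] at this
    simpa [Matrix.mulVec, dotProduct, Matrix.gram_apply, inner_smul_right, mul_comm] using this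
  exact congrFun (Matrix.eq_zero_of_mulVec_eq_zero h hz)

theorem exists_basis_of_det_gram_ne_zero {n : ℕ} {v : Fin n → EuclideanSpace ℝ (Fin n)}
    (h : (Matrix.gram ℝ v).det ≠ 0) : ∃ b : Basis (Fin n) ℝ (EuclideanSpace ℝ (Fin n)), ⇑b = v := by
  have hli := linearIndependent_of_det_gram_ne_zero h
  exact ⟨Basis.mk hli (hli.span_eq_top_of_card_eq_finrank' (by simp)).ge, Basis.coe_mk _ _⟩

theorem norm_sq_sum_smul {n : ℕ} (v : Fin n → EuclideanSpace ℝ (Fin n)) (y : Fin n → ℝ) :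
    ‖∑ i, y i • v i‖ ^ 2 = ∑ i, ∑ j, y i * y j * Matrix.gram ℝ v i j := by
  rw [← real_inner_self_eq_norm_sq, sum_inner]
  simp_rw [inner_sum, inner_smul_left, inner_smul_right, Matrix.gram_apply]
  simp [mul_assoc]

/-- If the squared norms of lattice vectors are integer multiples of `m > 0`, then a lattice vector
of squared norm `m` is shortest. -/
theorem isLeast_norm_sq_of_integral {n : ℕ} {L : Submodule ℤ (EuclideanSpace ℝ (Fin n))} {m : ℝ}
    (hm : 0 < m) (h : ∀ v ∈ L, ∃ k : ℤ, ‖v‖ ^ 2 = k * m) (hex : ∃ v ∈ L, ‖v‖ ^ 2 = m) :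
    IsLeast {r | ∃ v ∈ L, v ≠ 0 ∧ r = ‖v‖ ^ 2} m := by
  constructor
  · obtain ⟨v, hv, hvm⟩ := hex
    refine ⟨v, hv, ?_, hvm.symm⟩
    rintro rfl
    simp at hvm
    exact hm.ne hvm
  · rintro _ ⟨v, hv, hv0, rfl⟩
    obtain ⟨k, hk⟩ := h v hv
    rw [hk]
    have hpos : 0 < (k : ℝ) * m := by
      rw [← hk]
      have := norm_pos_iff.2 hv0
      positivity
    have : (0 : ℝ) < k := pos_of_mul_pos_left hpos hm.le
    have : (1 : ℝ) ≤ k := by exact_mod_cast this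
    nlinarith

/-! ### The root lattice A₃ and the extremal 3-torus -/

section DimensionThree

variable {η : Fin 3 → EuclideanSpace ℝ (Fin 3)}

theorem exists_gram_eq_gramThree :
    ∃ η : Fin 3 → EuclideanSpace ℝ (Fin 3), Matrix.gram ℝ η = gramThree := by
  have h : √2⁻¹ * √2⁻¹ = 1 / 2 := by rw [Real.mul_self_sqrt (by norm_num)]; norm_num
  -- Simple roots of D₃ = A₃, scaled to unit length.
  refine ⟨![√2⁻¹ • !₂[1, -1, 0], √2⁻¹ • !₂[0, 1, -1], √2⁻¹ • !₂[-1, -1, 0]], ?_⟩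
  ext i j
  rw [Matrix.gram_apply, real_inner_eq_sum, Fin.sum_univ_three]
  generalize √2⁻¹ = s at h
  fin_cases i <;> fin_cases j <;> simp [gramThree] <;> linarith

theorem det_gramThree : gramThree.det = 1 / 2 := by
  simp [gramThree, Matrix.det_fin_three]
  norm_num

theorem norm_sq_sum_smul_three (hη : Matrix.gram ℝ η = gramThree) (y : Fin 3 → ℝ) :
    ‖∑ i, y i • η i‖ ^ 2 = y 0 ^ 2 + y 1 ^ 2 + y 2 ^ 2 - y 0 * y 1 - y 1 * y 2 := by
  rw [norm_sq_sum_smul, hη]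
  simp [gramThree, Fin.sum_univ_three]
  ring

theorem isLeast_norm_sq_three (hη : Matrix.gram ℝ η = gramThree) :
    IsLeast {r | ∃ v ∈ span ℤ (Set.range η), v ≠ 0 ∧ r = ‖v‖ ^ 2} 1 := by
  refine isLeast_norm_sq_of_integral one_pos (fun v hv => ?_)
    ⟨η 0, subset_span ⟨0, rfl⟩, ?_⟩
  · obtain ⟨c, rfl⟩ := (mem_span_range_iff_exists_fun ℤ).1 hv
    refine ⟨c 0 ^ 2 + c 1 ^ 2 + c 2 ^ 2 - c 0 * c 1 - c 1 * c 2, ?_⟩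
    simp_rw [← Int.cast_smul_eq_zsmul ℝ]
    rw [norm_sq_sum_smul_three hη]
    push_cast
    ring
  · rw [← real_inner_self_eq_norm_sq, ← Matrix.gram_apply, hη]
    simp [gramThree]

theorem covolume_sq_three (hη : Matrix.gram ℝ η = gramThree) :
    ZLattice.covolume (span ℤ (Set.range η)) ^ 2 = 1 / 2 := by
  obtain ⟨b, rfl⟩ := exists_basis_of_det_gram_ne_zero (v := η) (by simp [hη, det_gramThree])
  rw [covolume_sq_eq_det_gram, hη, det_gramThree]

theorem hermiteInvariants_three_mem : (2 : ℝ) ^ ((1 : ℝ) / 3) ∈ hermiteInvariants 3 := by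
  obtain ⟨η, hη⟩ := exists_gram_eq_gramThree
  have hc := covolume_sq_three hη
  have hm := isLeast_norm_sq_three hη
  obtain ⟨b, rfl⟩ := exists_basis_of_det_gram_ne_zero (v := η) (by simp [hη, det_gramThree])
  have hpos := ZLattice.covolume_pos (span ℤ (Set.range b)) MeasureTheory.volume
  refine ⟨span ℤ (Set.range b), inferInstance, ?_, 1, hm, ?_⟩
  · rw [span_span_of_tower, b.span_eq]
  · set c := ZLattice.covolume (span ℤ (Set.range b))
    have : c ^ ((2 : ℝ) / (3 : ℕ)) = (1 / 2) ^ ((1 : ℝ) / 3) := by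
      rw [← hc, ← Real.rpow_natCast c 2, ← Real.rpow_mul hpos.le]
      norm_num
    rw [this, one_div 2, Real.inv_rpow (by norm_num), one_div, one_div, inv_inv]

/-- The six frequencies are the positive roots of A₃ scaled to length one. By Weyl symmetry they
form a tight frame, with constant 6/3 = 2 by the trace; here this is checked in coordinates. -/
theorem frame_three (hη : Matrix.gram ℝ η = gramThree) (v : EuclideanSpace ℝ (Fin 3)) :
    ∑ j, inner ℝ (∑ k, coordsThree j k • η k) v ^ 2 = 2 * ‖v‖ ^ 2 := by
  obtain ⟨b, rfl⟩ := exists_basis_of_det_gram_ne_zero (v := η) (by simp [hη, det_gramThree])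
  set y := b.repr v
  have hy : ∑ i, y i • b i = v := b.sum_repr v
  have hk : ∀ k, inner ℝ (b k) v = ∑ i, gramThree k i * y i := by
    intro k
    rw [← hy, inner_sum, ← hη]
    simp [inner_smul_right, Matrix.gram_apply, mul_comm]
  have hn : ‖v‖ ^ 2 = y 0 ^ 2 + y 1 ^ 2 + y 2 ^ 2 - y 0 * y 1 - y 1 * y 2 := by
    rw [← norm_sq_sum_smul_three hη, hy]
  rw [hn]
  simp_rw [← Int.cast_smul_eq_zsmul ℝ, sum_inner, inner_smul_left, hk]
  simp [Fin.sum_univ_succ, coordsThree, gramThree]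
  ring

theorem norm_sq_coordsThree (hη : Matrix.gram ℝ η = gramThree) (j : Fin 6) :
    ‖∑ k, coordsThree j k • η k‖ ^ 2 = 1 := by
  simp_rw [← Int.cast_smul_eq_zsmul ℝ]
  rw [norm_sq_sum_smul_three hη]
  fin_cases j <;> simp [coordsThree]

theorem immersionThree_apply (u : EuclideanSpace ℝ (Fin 3)) (j : Fin 6) :
    immersionThree η u j =
      ((√(1 / 6) : ℝ) : ℂ) * expInner (∑ k, coordsThree j k • η k) u := by
  rw [immersionThree, expInner]

theorem exists_torus_three (hη : Matrix.gram ℝ η = gramThree) :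
    ∃ T : FlatTorus 3, T.lattice = dualLattice (span ℤ (Set.range η)) ∧
      T.scale = 4 * π ^ 2 / 3 ∧
      (∃ x : T.Carrier → EuclideanSpace ℂ (Fin 6),
        (∀ u, x (T.proj u) = immersionThree η u) ∧ T.IsLambdaOneMinimal x) ∧
      T.functional = 4 * (2 : ℝ) ^ ((1 : ℝ) / 3) * π ^ 2 := by
  obtain ⟨b, hb⟩ := exists_basis_of_det_gram_ne_zero (v := η) (by simp [hη, det_gramThree])
  obtain ⟨b', hbb', hdual, hdual'⟩ := dualLattice_span_eq b
  have hcov := covolume_mul_covolume_of_dual b b' hbb'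
  rw [hb] at hcov hdual hdual'
  obtain ⟨T, hTl, hTs⟩ : ∃ T : FlatTorus 3, T.lattice = span ℤ (Set.range b') ∧
      T.scale = 4 * π ^ 2 / 3 :=
    ⟨⟨span ℤ (Set.range b'), inferInstance, by rw [span_span_of_tower, b'.span_eq],
      4 * π ^ 2 / 3, by positivity⟩, rfl, rfl⟩
  rw [← hTl] at hcov hdual hdual'
  have hTd : dualLattice T.lattice = span ℤ (Set.range η) := hdual'
  have hmin : IsLeast {r | ∃ v ∈ dualLattice T.lattice, v ≠ 0 ∧ r = ‖v‖ ^ 2} 1 := by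
    rw [hTd]
    exact isLeast_norm_sq_three hη
  have hmem (j : Fin 6) : ∑ k, coordsThree j k • η k ∈ dualLattice T.lattice := by
    rw [hTd]
    exact sum_mem fun k _ => smul_mem _ _ (subset_span ⟨k, rfl⟩)
  have hper : ∀ u, ∀ l ∈ T.lattice, immersionThree η (u + l) = immersionThree η u := by
    intro u l hl
    ext j
    rw [immersionThree_apply, immersionThree_apply, expInner_add_of_mem_dual (hmem j) u hl]
  refine ⟨T, hdual.symm, hTs, ⟨T.descend (immersionThree η), T.descend_proj hper, ?_⟩, ?_⟩
  · refine T.isLambdaOneMinimal_of_frame (fun _ => √(1 / 6))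
      (fun j => ∑ k, coordsThree j k • η k) (fun u j => ?_) ?_ (fun v => ?_) fun j => ?_
    · rw [T.descend_proj hper, immersionThree_apply]
    · simp
    -- The induced metric has factor 4π² · 1/6 · 2 = 4π²/3.
    · rw [← Finset.mul_sum, frame_three hη, Real.sq_sqrt (by norm_num)]
      rw [hTs]
      ring
    · rw [T.lambdaOne_eq hmin, norm_sq_coordsThree hη]
  · rw [T.functional_eq (by norm_num) hmin]
    have hc := covolume_sq_three hη
    have hpos := ZLattice.covolume_pos T.lattice MeasureTheory.volume
    have hc2 : ZLattice.covolume T.lattice ^ 2 = 2 := by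
      have : ZLattice.covolume T.lattice ^ 2 * (1 / 2) = 1 := by
        rw [← hc, ← mul_pow, mul_comm, hcov, one_pow]
      linarith
    set c := ZLattice.covolume T.lattice
    have : c ^ ((2 : ℝ) / (3 : ℕ)) = (c ^ 2) ^ ((1 : ℝ) / 3) := by
      rw [← Real.rpow_natCast c 2, ← Real.rpow_mul hpos.le]
      norm_num
    rw [this, hc2]
    ring

end DimensionThree

/-! ### The root lattice D₄ and the extremal 4-torus -/

section DimensionFour

/-- The generators of the lattice `latticeFour`. -/
noncomputable def generatorsFour : Fin 4 → EuclideanSpace ℝ (Fin 4) :=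
  ![!₂[1, 0, 0, -1], !₂[0, 1, 0, -1], !₂[0, 0, 1, -1], !₂[0, 0, 0, 2]]

theorem latticeFour_eq : latticeFour = span ℤ (Set.range generatorsFour) := by
  rw [latticeFour, generatorsFour]
  congr 1
  ext v
  constructor
  · rintro (rfl | rfl | rfl | rfl)
    exacts [⟨0, rfl⟩, ⟨1, rfl⟩, ⟨2, rfl⟩, ⟨3, rfl⟩]
  · rintro ⟨i, rfl⟩
    fin_cases i <;> simp

theorem gram_generatorsFour : Matrix.gram ℝ generatorsFour =
    !![2, 1, 1, -2; 1, 2, 1, -2; 1, 1, 2, -2; -2, -2, -2, 4] := by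
  ext i j
  rw [Matrix.gram_apply, real_inner_eq_sum, Fin.sum_univ_four]
  fin_cases i <;> fin_cases j <;> simp [generatorsFour] <;> norm_num

theorem det_gram_generatorsFour : (Matrix.gram ℝ generatorsFour).det = 4 := by
  rw [gram_generatorsFour]
  simp [Matrix.det_succ_row_zero, Fin.sum_univ_succ, Fin.succAbove]
  norm_num

theorem exists_basis_generatorsFour :
    ∃ b : Basis (Fin 4) ℝ (EuclideanSpace ℝ (Fin 4)), ⇑b = generatorsFour :=
  exists_basis_of_det_gram_ne_zero (by simp [det_gram_generatorsFour])

theorem covolume_latticeFour : ZLattice.covolume latticeFour = 2 := by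
  obtain ⟨b, hb⟩ := exists_basis_generatorsFour
  rw [latticeFour_eq, ← hb]
  have hpos := ZLattice.covolume_pos (span ℤ (Set.range b)) MeasureTheory.volume
  have h := covolume_sq_eq_det_gram b
  rw [hb, det_gram_generatorsFour, ← hb] at h
  nlinarith

theorem isLeast_norm_sq_four :
    IsLeast {r | ∃ v ∈ latticeFour, v ≠ 0 ∧ r = ‖v‖ ^ 2} 2 := by
  rw [latticeFour_eq]
  refine isLeast_norm_sq_of_integral two_pos (fun v hv => ?_)
    ⟨generatorsFour 0, subset_span ⟨0, rfl⟩, ?_⟩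
  · obtain ⟨c, rfl⟩ := (mem_span_range_iff_exists_fun ℤ).1 hv
    -- Half the Gram form, which is integral because D₄ is an even lattice.
    refine ⟨c 0 ^ 2 + c 1 ^ 2 + c 2 ^ 2 + 2 * c 3 ^ 2 + c 0 * c 1 + c 0 * c 2 + c 1 * c 2 -
      2 * (c 0 + c 1 + c 2) * c 3, ?_⟩
    simp_rw [← Int.cast_smul_eq_zsmul ℝ]
    rw [norm_sq_sum_smul, gram_generatorsFour]
    simp [Fin.sum_univ_four]
    ring
  · rw [← real_inner_self_eq_norm_sq, ← Matrix.gram_apply, gram_generatorsFour]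
    simp

theorem isLeast_norm_sq_dual_four :
    IsLeast {r | ∃ v ∈ dualLattice latticeFour, v ≠ 0 ∧ r = ‖v‖ ^ 2} 1 := by
  refine isLeast_norm_sq_of_integral one_pos (fun v hv => ?_) ⟨!₂[1, 0, 0, 0], ?_, ?_⟩
  · rw [latticeFour, mem_dualLattice_span] at hv
    obtain ⟨p, hp⟩ := hv !₂[1, 0, 0, -1] (by simp)
    obtain ⟨q, hq⟩ := hv !₂[0, 1, 0, -1] (by simp)
    obtain ⟨r, hr⟩ := hv !₂[0, 0, 1, -1] (by simp)
    obtain ⟨s, hs⟩ := hv !₂[0, 0, 0, 2] (by simp)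
    simp [real_inner_eq_sum, Fin.sum_univ_four] at hp hq hr hs
    -- The pairings determine v = (p + s/2, q + s/2, r + s/2, s/2), and the four terms s²/4 add up
    -- to s².
    refine ⟨p ^ 2 + p * s + q ^ 2 + q * s + r ^ 2 + r * s + s ^ 2, ?_⟩
    rw [EuclideanSpace.real_norm_sq_eq, Fin.sum_univ_four]
    push_cast
    rw [← hp, ← hq, ← hr, ← hs]
    ring
  · rw [latticeFour, mem_dualLattice_span]
    rintro v (rfl | rfl | rfl | rfl) <;>
      simp [real_inner_eq_sum, Fin.sum_univ_four]
    exacts [⟨1, by simp⟩, ⟨0, by simp⟩, ⟨0, by simp⟩, ⟨0, by simp⟩]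
  · rw [EuclideanSpace.real_norm_sq_eq, Fin.sum_univ_four]
    simp

theorem hermiteInvariants_four_mem : √2 ∈ hermiteInvariants 4 := by
  obtain ⟨b, hb⟩ := exists_basis_generatorsFour
  have hL : latticeFour = span ℤ (Set.range b) := by rw [hb, latticeFour_eq]
  refine ⟨latticeFour, ?_, ?_, 2, isLeast_norm_sq_four, ?_⟩
  · rw [hL]
    infer_instance
  · rw [hL, span_span_of_tower, b.span_eq]
  · rw [covolume_latticeFour, show (2 : ℝ) / (4 : ℕ) = 1 / 2 by norm_num, ← Real.sqrt_eq_rpow,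
      Real.div_sqrt]

/-- The frequency vectors of the four-dimensional example. -/
noncomputable def frequenciesFour : Fin 12 → EuclideanSpace ℝ (Fin 4) :=
  ![!₂[1/2, 1/2, 1/2, 1/2], !₂[1/2, 1/2, -1/2, -1/2], !₂[1/2, -1/2, 1/2, -1/2],
    !₂[-1/2, 1/2, 1/2, -1/2], !₂[1/2, 1/2, 1/2, -1/2], !₂[1/2, 1/2, -1/2, 1/2],
    !₂[1/2, -1/2, 1/2, 1/2], !₂[1/2, -1/2, -1/2, -1/2], !₂[1, 0, 0, 0], !₂[0, 1, 0, 0],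
    !₂[0, 0, 1, 0], !₂[0, 0, 0, 1]]

theorem frequenciesFour_mem (j : Fin 12) : frequenciesFour j ∈ dualLattice latticeFour := by
  rw [latticeFour, mem_dualLattice_span]
  rintro v (rfl | rfl | rfl | rfl) <;> fin_cases j <;>
    simp [frequenciesFour, real_inner_eq_sum, Fin.sum_univ_four] <;> norm_num <;>
    first
    | (refine ⟨0, ?_⟩; norm_num; done)
    | (refine ⟨1, ?_⟩; norm_num; done)
    | (refine ⟨-1, ?_⟩; norm_num; done)
    | (refine ⟨2, ?_⟩; norm_num)

theorem norm_sq_frequenciesFour (j : Fin 12) : ‖frequenciesFour j‖ ^ 2 = 1 := by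
  rw [EuclideanSpace.real_norm_sq_eq, Fin.sum_univ_four]
  fin_cases j <;> simp [frequenciesFour] <;> norm_num

/-- The amplitudes of the four-dimensional example. -/
noncomputable def amplitudesFour (a₁ a₂ a₃ : ℝ) : Fin 12 → ℝ :=
  ![a₁, a₁, a₁, a₁, a₂, a₂, a₂, a₂, a₃, a₃, a₃, a₃]

theorem immersionFour_apply (a₁ a₂ a₃ : ℝ) (u : EuclideanSpace ℝ (Fin 4)) (j : Fin 12) :
    immersionFour a₁ a₂ a₃ u j =
      (amplitudesFour a₁ a₂ a₃ j : ℂ) * expInner (frequenciesFour j) u := by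
  fin_cases j <;>
    simp [immersionFour, amplitudesFour, frequenciesFour, expInner, real_inner_eq_sum,
      Fin.sum_univ_four] <;> left <;> congr 1 <;> ring

/-- The twelve frequencies split into three orthonormal bases, one for each amplitude. Only the sum
of the squared amplitudes matters, so the induced metric does not depend on the parameters. -/
theorem frame_four {a₁ a₂ a₃ : ℝ} (ha : a₁ ^ 2 + a₂ ^ 2 + a₃ ^ 2 = 1 / 4)
    (v : EuclideanSpace ℝ (Fin 4)) :
    ∑ j, amplitudesFour a₁ a₂ a₃ j ^ 2 * inner ℝ (frequenciesFour j) v ^ 2 = 1 / 4 * ‖v‖ ^ 2 := by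
  rw [← ha, EuclideanSpace.real_norm_sq_eq]
  simp [amplitudesFour, frequenciesFour, real_inner_eq_sum, Fin.sum_univ_succ]
  ring

theorem exists_torus_four {a₁ a₂ a₃ : ℝ} (ha : a₁ ^ 2 + a₂ ^ 2 + a₃ ^ 2 = 1 / 4) :
    ∃ T : FlatTorus 4, T.lattice = latticeFour ∧ T.scale = π ^ 2 ∧
      (∃ x : T.Carrier → EuclideanSpace ℂ (Fin 12),
        (∀ u, x (T.proj u) = immersionFour a₁ a₂ a₃ u) ∧ T.IsLambdaOneMinimal x) ∧
      T.functional = 4 * √2 * π ^ 2 := by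
  obtain ⟨b, hb⟩ := exists_basis_generatorsFour
  have hL : latticeFour = span ℤ (Set.range b) := by rw [hb, latticeFour_eq]
  obtain ⟨T, hTl, hTs⟩ : ∃ T : FlatTorus 4, T.lattice = latticeFour ∧ T.scale = π ^ 2 :=
    ⟨⟨latticeFour, by rw [hL]; infer_instance, by rw [hL, span_span_of_tower, b.span_eq],
      π ^ 2, by positivity⟩, rfl, rfl⟩
  have hmin : IsLeast {r | ∃ v ∈ dualLattice T.lattice, v ≠ 0 ∧ r = ‖v‖ ^ 2} 1 := by
    rw [hTl]
    exact isLeast_norm_sq_dual_four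
  have hper : ∀ u, ∀ l ∈ T.lattice,
      immersionFour a₁ a₂ a₃ (u + l) = immersionFour a₁ a₂ a₃ u := by
    intro u l hl
    rw [hTl] at hl
    ext j
    rw [immersionFour_apply, immersionFour_apply,
      expInner_add_of_mem_dual (frequenciesFour_mem j) u hl]
  refine ⟨T, hTl, hTs, ⟨T.descend (immersionFour a₁ a₂ a₃), T.descend_proj hper, ?_⟩, ?_⟩
  · refine T.isLambdaOneMinimal_of_frame (amplitudesFour a₁ a₂ a₃) frequenciesFour
      (fun u j => ?_) ?_ (fun v => ?_) fun j => ?_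
    · rw [T.descend_proj hper, immersionFour_apply]
    · simp [amplitudesFour, Fin.sum_univ_succ]
      linarith
    · rw [frame_four ha]
      rw [hTs]
      ring
    · rw [T.lambdaOne_eq hmin, norm_sq_frequenciesFour]
  · rw [T.functional_eq (by norm_num) hmin]
    rw [hTl, covolume_latticeFour, show (2 : ℝ) / (4 : ℕ) = 1 / 2 by norm_num, ← Real.sqrt_eq_rpow]
    ring

end DimensionFour

theorem theorem1 :
    -- dimension three
    ((∀ T : FlatTorus 3, IsLeast T.positiveSpectrum T.lambdaOne ∧
        T.functional ≤ 4 * (2 : ℝ) ^ ((1 : ℝ) / 3) * π ^ 2) ∧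
      (∃ η : Fin 3 → EuclideanSpace ℝ (Fin 3), Matrix.gram ℝ η = gramThree) ∧
      (∀ η : Fin 3 → EuclideanSpace ℝ (Fin 3), Matrix.gram ℝ η = gramThree →
        ∃ T : FlatTorus 3, T.lattice = dualLattice (Submodule.span ℤ (Set.range η)) ∧
          T.scale = 4 * π ^ 2 / 3 ∧
          (∃ x : T.Carrier → EuclideanSpace ℂ (Fin 6),
            (∀ u, x (T.proj u) = immersionThree η u) ∧ T.IsLambdaOneMinimal x) ∧
          T.functional = 4 * (2 : ℝ) ^ ((1 : ℝ) / 3) * π ^ 2)) ∧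
    -- dimension four
    ((∀ T : FlatTorus 4, IsLeast T.positiveSpectrum T.lambdaOne ∧
        T.functional ≤ 4 * √2 * π ^ 2) ∧
      (∀ a₁ a₂ a₃ : ℝ, 0 ≤ a₁ → a₁ ≤ a₂ → a₂ ≤ a₃ → a₁ ^ 2 + a₂ ^ 2 + a₃ ^ 2 = 1 / 4 →
        ∃ T : FlatTorus 4, T.lattice = latticeFour ∧ T.scale = π ^ 2 ∧
          (∃ x : T.Carrier → EuclideanSpace ℂ (Fin 12),
            (∀ u, x (T.proj u) = immersionFour a₁ a₂ a₃ u) ∧ T.IsLambdaOneMinimal x) ∧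
          T.functional = 4 * √2 * π ^ 2)) ∧
    -- the Hermite constants
    IsGreatest (hermiteInvariants 3) ((2 : ℝ) ^ ((1 : ℝ) / 3)) ∧
    IsGreatest (hermiteInvariants 4) (√2) := by
  refine ⟨⟨fun T => ⟨T.isLeast_lambdaOne (by norm_num), ?_⟩, exists_gram_eq_gramThree,
    fun η hη => exists_torus_three hη⟩, ⟨fun T => ⟨T.isLeast_lambdaOne (by norm_num), ?_⟩,
    fun a₁ a₂ a₃ _ _ _ ha => exists_torus_four ha⟩,
    ⟨hermiteInvariants_three_mem, hermiteInvariants_three_le⟩,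
    ⟨hermiteInvariants_four_mem, hermiteInvariants_four_le⟩⟩
  · linarith [T.functional_le (by norm_num) hermiteInvariants_three_le]
  · linarith [T.functional_le (by norm_num) hermiteInvariants_four_le]
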